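/- Let $m,n\ge 1$ be integers, $1<p_1,\dots,p_m<\infty$, $\vec P=(p_1,\dots,p_m)$, $\frac1p=\frac1{p_1}+\cdots+\frac1{p_m}$, $0<\alpha<mn$, $\frac1m<p<\frac n\alpha$ and $\frac1q=\frac1p-\frac\alpha n$; write $p_i'=p_i/(p_i-1)$. For measurable functions $\vec f=(f_1,\dots,f_m)$ on $\mathbb R^n$ put $$\mathcal M_\alpha(\vec f)(x)=\sup_{Q\ni x}\prod_{i=1}^m\frac1{|Q|^{1-\frac{\alpha}{mn}}}\int_Q|f_i(y_i)|\,dy_i ,$$ and for measurable $\vec\omega=(\omega_1,\dots,\omega_m)$ with each $\omega_i:\mathbb R^n\to[0,\infty)$ put $\nu_{\vec\omega}=\prod_{i=1}^m\omega_i$ and $$[\vec\omega]_{A_{(\vec P,q)}}=\sup_Q\Big(\frac1{|Q|}\int_Q\nu_{\vec\omega}^q\Big)\prod_{i=1}^m\Big(\frac1{|Q|}\int_Q\omega_i^{-p_i'}\Big)^{q/p_i'},$$ the suprema being over cubes $Q\subset\mathbb R^n$ with sides parallel to the axes (containing $x$ in the first case); $\vec\omega\in A_{(\vec P,q)}$ means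 $[\vec\omega]_{A_{(\vec P,q)}}<\infty$. Call $\gamma\in\mathbb R$ admissible if there is a constant $C=C(n,m,\vec P,q)<\infty$ such that $$\|\mathcal M_\alpha(\vec f)\|_{L^q(\nu_{\vec\omega}^q)}\le C\,[\vec\omega]_{A_{(\vec P,q)}}^{\gamma}\prod_{i=1}^m\|f_i\|_{L^{p_i}(\omega_i^{p_i})}$$ for all $\vec\omega\in A_{(\vec P,q)}$ and all measurable $\vec f$, and let the best power $\gamma(p_1,\dots,p_m)$ be the infimum of the admissible powers. Then $\frac1q\big(1-\frac{\alpha}{mn}\big)\max\{p_1',\dots,p_m'\}$ is admissible, no number smaller than $\frac{mp}{q(mp-1)}\big(1-\frac\alpha{mn}\big)$ is admissible, and consequently $$\frac{mp}{q(mp-1)}\Big(1-\frac{\alpha}{mn}\Big)\le\gamma(p_1,\dots,p_m)\le\frac1q\Big(1-\frac{\alpha}{mn}\Big)\max\{p_1',\dots,p_m'\}.$$ In particular, if $p_1=\cdots=p_m=r$, then $\gamma(r,\dots,r)=\frac{r'}{q}\big(1-\frac{\alpha}{mn}\big)$, and this power is sharp: it is the smallest admissible power. -/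

import Mathlib

open MeasureTheory
open scoped ENNReal NNReal

noncomputable section

namespace MultilinearFractional

/-- The closed cube in `ℝⁿ` with sides parallel to the axes, lower corner `a` and side length `ℓ`
(used only for `0 < ℓ`). -/
def cube {n : ℕ} (a : Fin n → ℝ) (ℓ : ℝ) : Set (Fin n → ℝ) :=
  {x | ∀ j, a j ≤ x j ∧ x j ≤ a j + ℓ}

/-- The multilinear fractional maximal operator
`M_α(f₁, …, f_m)(x) = sup_{Q ∋ x} ∏ᵢ |Q|^{-(1 - α/(mn))} ∫_Q |fᵢ|`, with values in `[0, ∞]`;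
the supremum is over all cubes with sides parallel to the axes that contain `x`. -/
def fracMaximal {n m : ℕ} (α : ℝ) (f : Fin m → (Fin n → ℝ) → ℂ) (x : Fin n → ℝ) : ℝ≥0∞ :=
  ⨆ (a : Fin n → ℝ) (ℓ : ℝ) (_ : 0 < ℓ) (_ : x ∈ cube a ℓ),
    ∏ i, (volume (cube a ℓ) ^ (1 - α / ((m : ℝ) * n)))⁻¹ * ∫⁻ y in cube a ℓ, ‖f i y‖ₑ

/-- The product weight `ν_ω = ∏ᵢ ωᵢ`. -/
def prodWeight {n m : ℕ} (ω : Fin m → (Fin n → ℝ) → ℝ≥0) (x : Fin n → ℝ) : ℝ≥0∞ :=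
  ∏ i, (ω i x : ℝ≥0∞)

/-- The `A_{(P,q)}` constant
`sup_Q (⨍_Q ν_ω^q) ∏ᵢ (⨍_Q ωᵢ^{-pᵢ'})^{q/pᵢ'}`, with values in `[0, ∞]`
(so that `ωᵢ^{-pᵢ'} = ∞` where `ωᵢ = 0`). -/
def weightConst {n m : ℕ} (p : Fin m → ℝ) (q : ℝ) (ω : Fin m → (Fin n → ℝ) → ℝ≥0) : ℝ≥0∞ :=
  ⨆ (a : Fin n → ℝ) (ℓ : ℝ) (_ : 0 < ℓ),
    (⨍⁻ x in cube a ℓ, prodWeight ω x ^ q ∂volume) *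
      ∏ i, (⨍⁻ x in cube a ℓ, (ω i x : ℝ≥0∞) ^ (-(p i).conjExponent) ∂volume) ^
        (q / (p i).conjExponent)

/-- The class `A_{(P,q)}` of multiple weights. -/
def IsWeight {n m : ℕ} (p : Fin m → ℝ) (q : ℝ) (ω : Fin m → (Fin n → ℝ) → ℝ≥0) : Prop :=
  (∀ i, AEMeasurable (ω i) volume) ∧ weightConst p q ω < ∞

/-- The set of all powers `γ` for which there is a constant `C`, independent of the weights and of
the functions, such that
`‖M_α(f)‖_{L^q(ν_ω^q)} ≤ C [ω]_{A_{(P,q)}}^γ ∏ᵢ ‖fᵢ‖_{L^{pᵢ}(ωᵢ^{pᵢ})}`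
for all `ω ∈ A_{(P,q)}` on `ℝⁿ` and all measurable `f₁, …, f_m`. -/
def admissiblePowers (n : ℕ) {m : ℕ} (α : ℝ) (p : Fin m → ℝ) (q : ℝ) : Set ℝ :=
  {γ | ∃ C : ℝ≥0, ∀ ω : Fin m → (Fin n → ℝ) → ℝ≥0, IsWeight p q ω →
    ∀ f : Fin m → (Fin n → ℝ) → ℂ, (∀ i, AEMeasurable (f i) volume) →
      eLpNorm (fracMaximal α f) (ENNReal.ofReal q)
          (volume.withDensity fun x => prodWeight ω x ^ q) ≤
        C * weightConst p q ω ^ γ *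
          ∏ i, eLpNorm (f i) (ENNReal.ofReal (p i))
            (volume.withDensity fun x => (ω i x : ℝ≥0∞) ^ p i)}

/-- The best power: the infimum of the admissible powers. -/
def bestPower (n : ℕ) {m : ℕ} (α : ℝ) (p : Fin m → ℝ) (q : ℝ) : ℝ :=
  sInf (admissiblePowers n α p q)

end MultilinearFractional

end

/-! Upper bound. Put $v=\nu_{\vec\omega}^q$, $\sigma_i=\omega_i^{-p_i'}$, $g_i=|f_i|/\sigma_i$,
$s=m-\alpha/n$ and $\pi=(1-\frac{\alpha}{mn})\max_i p_i'>1$. Almost everywhere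
$v^{1/q}\prod\sigma_i^{1/p_i'}=1$. Distribute $\alpha/n=\sum r_i$ among the factors. In each $\int_Q
g_i\,d\sigma_i$ the power $r_ip_i$ goes to the global norm by Hölder. The remaining power $1-r_ip_i$
is a power of a $\sigma_i$-average, hence at most a maximal function $M_{\sigma_i}g_i$ at every
point of $Q$ (`setLIntegral_le_of_rpow`). Multiplying by the identity above to the power $\pi-1$ and
applying Hölder on $Q$ (`holder_auxDensity`) turns the product of these powers into a $v$-average,
so the multilinear average is at most $[\vec\omega]^{\pi/q}$ times norms times $M_v(F)(x)^{\pi/q}$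
(`prod_average_le`). Both layers of maximal functions are bounded on $L^{p_i}(\sigma_i)$ and
$L^\pi(v)$ with constants independent of the measure, by Besicovitch covering, and a last Hölder
inequality closes the estimate with the power $\pi/q$.

Lower bound. Test with $\omega_i=|x|^{(n-\delta)/p_i'}$ and $f_i=|x|^{\delta-n}1_{B(0,1)}$, in the
sup norm. As $\delta\to0$ the weight constant is $O(\delta^{-q(m-1/p)})$, the product of the norms
of the $f_i$ is of order $\delta^{-1/p}$, and the left side is at least a multiple of
$\delta^{-m-1/q}$. Comparing exponents gives $m-\alpha/n\le q(m-1/p)\gamma$. For equal exponents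
$mp=r$, and the two bounds coincide. -/

/-! ### Centered maximal functions with respect to an arbitrary measure -/

/-- The centered maximal function of `g` with respect to the measure `μ`, over closed balls of
positive rational radius. -/
noncomputable def centeredMaximal {E : Type*} [PseudoMetricSpace E] [MeasurableSpace E]
    (μ : Measure E) (g : E → ℝ≥0∞) (x : E) : ℝ≥0∞ :=
  ⨆ r : {r : ℚ // 0 < r}, (μ (Metric.closedBall x r.1))⁻¹ *
    ∫⁻ y in Metric.closedBall x r.1, g y ∂μ

theorem le_centeredMaximal {E : Type*} [PseudoMetricSpace E] [MeasurableSpace E]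
    (μ : Measure E) (g : E → ℝ≥0∞) (x : E) {r : ℚ} (hr : 0 < r) :
    (μ (Metric.closedBall x r))⁻¹ * ∫⁻ y in Metric.closedBall x r, g y ∂μ ≤
      centeredMaximal μ g x :=
  le_iSup (fun r : {r : ℚ // 0 < r} => (μ (Metric.closedBall x r.1))⁻¹ *
    ∫⁻ y in Metric.closedBall x r.1, g y ∂μ) ⟨r, hr⟩

theorem lintegral_rpow_indicator (p : ℝ) (hp : 0 < p) (a : ℝ≥0∞) :
    ∫⁻ t in Set.Ioi (0 : ℝ), ENNReal.ofReal (p * t ^ (p - 1)) *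
      {t | ENNReal.ofReal t < a}.indicator 1 t = a ^ p := by
  have key : ∀ b : ℝ, 0 ≤ b → ∫⁻ t in Set.Ioo 0 b, ENNReal.ofReal (p * t ^ (p - 1)) =
      ENNReal.ofReal b ^ p := by
    intro b hb
    have hint : IntervalIntegrable (fun t : ℝ => p * t ^ (p - 1)) volume 0 b :=
      (intervalIntegral.intervalIntegrable_rpow' (by linarith)).const_mul p
    rw [restrict_Ioo_eq_restrict_Ioc,
      ← ofReal_integral_eq_lintegral_ofReal hint.1, ← intervalIntegral.integral_of_le hb,
      intervalIntegral.integral_const_mul, integral_rpow (.inl (by linarith)),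
      ENNReal.ofReal_rpow_of_nonneg hb hp.le]
    · congr 1
      rw [sub_add_cancel, Real.zero_rpow hp.ne', sub_zero, mul_div_cancel₀ _ hp.ne']
    · filter_upwards [ae_restrict_mem measurableSet_Ioc] with t ht
      have := ht.1
      positivity
  have hind : ∀ b : ℝ, 0 ≤ b → ∫⁻ t in Set.Ioi (0 : ℝ), ENNReal.ofReal (p * t ^ (p - 1)) *
      {t | ENNReal.ofReal t < ENNReal.ofReal b}.indicator 1 t = ENNReal.ofReal b ^ p := by
    intro b hb
    rw [← key b hb, ← lintegral_indicator measurableSet_Ioi,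
      ← lintegral_indicator measurableSet_Ioo]
    congr 1 with t
    by_cases h0 : 0 < t
    · simp [Set.indicator, h0, ENNReal.ofReal_lt_ofReal_iff_of_nonneg h0.le]
    · simp [Set.indicator, h0]
  induction a with
  | coe a => simpa using hind a a.2
  | top =>
    rw [ENNReal.top_rpow_of_pos hp, eq_top_iff]
    have hN : ∀ N : ℕ, (N : ℝ≥0∞) ^ p ≤ ∫⁻ t in Set.Ioi (0 : ℝ), ENNReal.ofReal (p * t ^ (p - 1)) *
      {t | ENNReal.ofReal t < ∞}.indicator 1 t := by
      intro N
      rw [← ENNReal.ofReal_natCast, ← hind N (by positivity)]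
      gcongr
      exact le_top
    have hlim := ((ENNReal.continuous_rpow_const (y := p)).tendsto ∞).comp
      ENNReal.tendsto_nat_nhds_top
    rw [ENNReal.top_rpow_of_pos hp] at hlim
    exact le_of_tendsto' hlim hN

theorem measurable_indicator_ofReal_lt {E : Type*} [MeasurableSpace E] {g : E → ℝ≥0∞}
    (hg : Measurable g) :
    Measurable fun z : E × ℝ => {t | ENNReal.ofReal t < g z.1}.indicator (1 : ℝ → ℝ≥0∞) z.2 := by
  have hs : MeasurableSet {z : E × ℝ | ENNReal.ofReal z.2 < g z.1} :=
    measurableSet_lt (by fun_prop) (by fun_prop)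
  exact (measurable_one (α := ℝ≥0∞)).indicator hs

/-- Layer cake and Tonelli. The extra density `f` allows two uses in the strong type bound: with `f
= 1` to open the integral of the maximal function, and with `f = g` to close it. -/
theorem lintegral_mul_rpow_eq_lintegral_lt {E : Type*} [MeasurableSpace E]
    (μ : Measure E) [SFinite μ] {f g : E → ℝ≥0∞}
    (hf : Measurable f) (hg : Measurable g) {p : ℝ} (hp : 0 < p) :
    ∫⁻ x, f x * g x ^ p ∂μ = ∫⁻ t in Set.Ioi (0 : ℝ), ENNReal.ofReal (p * t ^ (p - 1)) *
      ∫⁻ x in {x | ENNReal.ofReal t < g x}, f x ∂μ := by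
  have hm := measurable_indicator_ofReal_lt hg
  calc ∫⁻ x, f x * g x ^ p ∂μ
      = ∫⁻ x, (∫⁻ t in Set.Ioi (0 : ℝ), f x * (ENNReal.ofReal (p * t ^ (p - 1)) *
          {t | ENNReal.ofReal t < g x}.indicator 1 t)) ∂μ := by
        congr 1 with x
        rw [lintegral_const_mul, lintegral_rpow_indicator p hp]
        exact .mul (by fun_prop) (hm.comp measurable_prodMk_left)
    _ = ∫⁻ t in Set.Ioi (0 : ℝ), ∫⁻ x, f x * (ENNReal.ofReal (p * t ^ (p - 1)) *
          {t | ENNReal.ofReal t < g x}.indicator 1 t) ∂μ :=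
        lintegral_lintegral_swap
          (((hf.comp measurable_fst).mul (.mul (by fun_prop) hm)).aemeasurable)
    _ = _ := by
        congr 1 with t
        rw [← lintegral_indicator (measurableSet_lt measurable_const hg),
          ← lintegral_const_mul _ (hf.indicator (measurableSet_lt measurable_const hg))]
        congr 1 with x
        by_cases h : ENNReal.ofReal t < g x
        · simp [Set.indicator, h, mul_comm]
        · simp [Set.indicator, h]

/-- The part of `g` not exceeding `t` contributes at most `t` to any average; this holds even for
balls of measure `0` or `∞`, since `μ(B)⁻¹ * μ(B) ≤ 1` always. -/
theorem centeredMaximal_le_add {E : Type*} [PseudoMetricSpace E] [MeasurableSpace E] (μ : Measure E)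
    (g : E → ℝ≥0∞) (t : ℝ≥0∞) (x : E) :
    centeredMaximal μ g x ≤ centeredMaximal μ ({x | t < g x}.indicator g) x + t := by
  refine iSup_le fun r => ?_
  calc (μ (Metric.closedBall x r.1))⁻¹ * ∫⁻ y in Metric.closedBall x r.1, g y ∂μ
      ≤ (μ (Metric.closedBall x r.1))⁻¹ *
          ∫⁻ y in Metric.closedBall x r.1, ({x | t < g x}.indicator g y + t) ∂μ := by
        gcongr with y
        by_cases h : t < g y
        · simp [Set.indicator, h]
        · simpa [Set.indicator, h] using not_lt.1 h
    _ = (μ (Metric.closedBall x r.1))⁻¹ *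
          ∫⁻ y in Metric.closedBall x r.1, {x | t < g x}.indicator g y ∂μ +
          t * ((μ (Metric.closedBall x r.1))⁻¹ * μ (Metric.closedBall x r.1)) := by
        rw [lintegral_add_right _ measurable_const, mul_add, setLIntegral_const]
        ring
    _ ≤ _ := by
        gcongr
        · exact le_centeredMaximal _ _ _ r.2
        · exact mul_le_of_le_one_right' (ENNReal.inv_mul_le_one _)

section CenteredMaximal

variable {E : Type*} [MetricSpace E] [SecondCountableTopology E] [MeasurableSpace E] [BorelSpace E]

theorem measurable_setLIntegral_closedBall (μ : Measure E) [SFinite μ] {g : E → ℝ≥0∞}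
    (hg : Measurable g) (r : ℝ) :
    Measurable fun x => ∫⁻ y in Metric.closedBall x r, g y ∂μ := by
  have hs : MeasurableSet {z : E × E | dist z.2 z.1 ≤ r} :=
    measurableSet_le (by fun_prop) measurable_const
  have h : Measurable fun z : E × E => {z : E × E | dist z.2 z.1 ≤ r}.indicator (fun z => g z.2) z :=
    (hg.comp measurable_snd).indicator hs
  convert h.lintegral_prod_right' (ν := μ) using 2 with x
  rw [← lintegral_indicator Metric.isClosed_closedBall.measurableSet]
  rfl

theorem measurable_measure_closedBall (μ : Measure E) [SFinite μ] (r : ℝ) :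
    Measurable fun x => μ (Metric.closedBall x r) := by
  simpa using measurable_setLIntegral_closedBall μ measurable_one r

theorem measurable_centeredMaximal (μ : Measure E) [SFinite μ] {g : E → ℝ≥0∞}
    (hg : Measurable g) : Measurable (centeredMaximal μ g) :=
  .iSup fun _ => (measurable_measure_closedBall μ _).inv.mul
    (measurable_setLIntegral_closedBall μ hg _)

/-- The weak type `(1, 1)` inequality, from the Besicovitch covering theorem. -/
theorem exists_centeredMaximal_weakType (E : Type*) [MetricSpace E] [SecondCountableTopology E]
    [MeasurableSpace E] [BorelSpace E] [HasBesicovitchCovering E] :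
    ∃ N : ℕ, ∀ (μ : Measure E) (g : E → ℝ≥0∞) (t : ℝ≥0∞),
      t * μ {x | t < centeredMaximal μ g x} ≤ N * ∫⁻ y, g y ∂μ := by
  obtain ⟨N, τ, hτ, hN⟩ := HasBesicovitchCovering.no_satelliteConfig (α := E)
  refine ⟨N, fun μ g t => ?_⟩
  -- The covering theorem needs bounded radii, so the level set is exhausted by points whose
  -- witnessing radius is at most `R`.
  let A : ℕ → Set E := fun R => {x | ∃ r : ℚ, 0 < r ∧ r ≤ R ∧
    t < (μ (Metric.closedBall x r))⁻¹ * ∫⁻ y in Metric.closedBall x r, g y ∂μ}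
  have hA : {x | t < centeredMaximal μ g x} = ⋃ R, A R := by
    ext x
    simp only [Set.mem_ofPred_eq, centeredMaximal, lt_iSup_iff, Set.mem_iUnion, A]
    constructor
    · rintro ⟨⟨r, hr⟩, h⟩
      obtain ⟨R, hR⟩ := exists_nat_ge r
      exact ⟨R, r, hr, hR, h⟩
    · rintro ⟨R, r, hr, -, h⟩
      exact ⟨⟨r, hr⟩, h⟩
  have hmono : Monotone A := by
    rintro R R' h x ⟨r, hr, hrR, hx⟩
    exact ⟨r, hr, hrR.trans (by exact_mod_cast h), hx⟩
  rw [hA, hmono.measure_iUnion, ENNReal.mul_iSup]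
  refine iSup_le fun R => ?_
  choose! r hr0 hrR hr using fun x (hx : x ∈ A R) => hx
  let q : Besicovitch.BallPackage (A R) E :=
    { c := fun x => x
      r := fun x => r x
      rpos := fun x => by exact_mod_cast hr0 x x.2
      r_bound := R
      r_le := fun x => by exact_mod_cast hrR x x.2 }
  obtain ⟨s, hdisj, hcov⟩ := Besicovitch.exist_disjoint_covering_families hτ hN q
  have hball : ∀ x : A R, t * μ (Metric.closedBall (q.c x) (q.r x)) ≤
      ∫⁻ y in Metric.closedBall (q.c x) (q.r x), g y ∂μ := by
    intro x
    have h := hr x x.2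
    -- The measure need not be locally finite: a ball of infinite measure has inverse measure `0`
    -- and cannot witness a strict inequality.
    by_cases h0 : μ (Metric.closedBall (x : E) (r x)) = 0
    · simp [q, h0]
    · by_cases h1 : μ (Metric.closedBall (x : E) (r x)) = ∞
      · simp [h1] at h
      · change t * μ (Metric.closedBall (x : E) (r x)) ≤ _
        rw [mul_comm] at h
        exact (ENNReal.le_div_iff_mul_le (.inl h0) (.inl h1)).1 h.le
  have hcount : ∀ i, (s i).Countable := fun i =>
    (hdisj i).countable_of_nonempty_interior fun x _ =>
      ⟨q.c x, Metric.ball_subset_interior_closedBall (Metric.mem_ball_self (q.rpos x))⟩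
  have hfam : ∀ i, t * μ (⋃ j ∈ s i, Metric.closedBall (q.c j) (q.r j)) ≤ ∫⁻ y, g y ∂μ := by
    intro i
    have := (hcount i).to_subtype
    calc t * μ (⋃ j ∈ s i, Metric.closedBall (q.c j) (q.r j))
        ≤ t * ∑' j : s i, μ (Metric.closedBall (q.c j) (q.r j)) := by
          gcongr
          exact measure_biUnion_le μ (hcount i) _
      _ = ∑' j : s i, t * μ (Metric.closedBall (q.c j) (q.r j)) := ENNReal.tsum_mul_left.symm
      _ ≤ ∑' j : s i, ∫⁻ y in Metric.closedBall (q.c j) (q.r j), g y ∂μ :=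
          ENNReal.tsum_le_tsum fun j => hball j
      _ = ∫⁻ y in ⋃ j ∈ s i, Metric.closedBall (q.c j) (q.r j), g y ∂μ :=
          (lintegral_biUnion (hcount i) (fun _ _ => Metric.isClosed_closedBall.measurableSet)
            (hdisj i) _).symm
      _ ≤ ∫⁻ y, g y ∂μ := setLIntegral_le_lintegral _ _
  calc t * μ (A R) ≤ t * ∑ i : Fin N, μ (⋃ j ∈ s i, Metric.closedBall (q.c j) (q.r j)) := by
        gcongr
        refine (measure_mono ?_).trans (measure_iUnion_fintype_le μ _)
        intro x hx
        obtain ⟨i, hi⟩ := Set.mem_iUnion.1 (hcov ⟨⟨x, hx⟩, rfl⟩)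
        refine Set.mem_iUnion.2 ⟨i, ?_⟩
        simp only [Set.mem_iUnion] at hi ⊢
        obtain ⟨j, hj, hj'⟩ := hi
        exact ⟨j, hj, Metric.ball_subset_closedBall hj'⟩
    _ = ∑ i : Fin N, t * μ (⋃ j ∈ s i, Metric.closedBall (q.c j) (q.r j)) := Finset.mul_sum ..
    _ ≤ ∑ _i : Fin N, ∫⁻ y, g y ∂μ := Finset.sum_le_sum fun i _ => hfam i
    _ = N * ∫⁻ y, g y ∂μ := by simp

/-- The strong type `(p, p)` inequality, with a constant independent of the measure. -/
theorem exists_centeredMaximal_strongType (E : Type*) [MetricSpace E] [SecondCountableTopology E]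
    [MeasurableSpace E] [BorelSpace E] [HasBesicovitchCovering E] {p : ℝ} (hp : 1 < p) :
    ∃ C : ℝ≥0, ∀ (μ : Measure E) [SFinite μ] (g : E → ℝ≥0∞), Measurable g →
      ∫⁻ x, centeredMaximal μ g x ^ p ∂μ ≤ C * ∫⁻ x, g x ^ p ∂μ := by
  obtain ⟨N, hN⟩ := exists_centeredMaximal_weakType E
  -- Truncating `g` at height `t / 2` gives `2 * N / t`; trading `p t^(p-1) / t` for `(p-1) t^(p-2)`
  -- gives `p / (p-1)`; the level sets of `2 * g` give `2^(p-1)`.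
  refine ⟨2 * N * Real.toNNReal (p / (p - 1)) * 2 ^ (p - 1), fun μ _ g hg => ?_⟩
  have h2g : Measurable fun x => 2 * g x := hg.const_mul 2
  have hweak : ∀ t : ℝ, 0 < t → μ {x | ENNReal.ofReal t < centeredMaximal μ g x} ≤
      ENNReal.ofReal t⁻¹ * (2 * N * ∫⁻ x in {x | ENNReal.ofReal t < 2 * g x}, g x ∂μ) := by
    intro t ht
    set T := ENNReal.ofReal t
    have hT0 : T ≠ 0 := by simpa [T] using ht
    have hTtop : T ≠ ∞ := ENNReal.ofReal_ne_top
    have hset : {x | T < 2 * g x} = {x | T / 2 < g x} := by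
      ext x
      simp only [Set.mem_ofPred_eq]
      rw [ENNReal.div_lt_iff (.inl two_ne_zero) (.inl ENNReal.ofNat_ne_top), mul_comm]
    have h1 := hN μ ({x | T / 2 < g x}.indicator g) (T / 2)
    rw [lintegral_indicator (measurableSet_lt measurable_const hg), ← hset] at h1
    have h2 : μ {x | T < centeredMaximal μ g x} ≤
        μ {x | T / 2 < centeredMaximal μ ({x | T / 2 < g x}.indicator g) x} := by
      refine measure_mono fun x hx => ?_
      by_contra hcon
      rw [Set.mem_ofPred_eq, not_lt] at hcon
      have h3 := (centeredMaximal_le_add μ g (T / 2) x).trans (add_le_add_left hcon _)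
      rw [ENNReal.add_halves] at h3
      exact absurd hx (not_lt.2 h3)
    rw [ENNReal.ofReal_inv_of_pos ht]
    calc μ {x | T < centeredMaximal μ g x} = T⁻¹ * (2 * (T / 2 * μ {x | T < centeredMaximal μ g x})) := by
          rw [← mul_assoc 2, ENNReal.mul_div_cancel two_ne_zero ENNReal.ofNat_ne_top, ← mul_assoc,
            ENNReal.inv_mul_cancel hT0 hTtop, one_mul]
      _ ≤ T⁻¹ * (2 * (N * ∫⁻ x in {x | T < 2 * g x}, g x ∂μ)) := by
          rw [← hset] at h2
          exact mul_le_mul_right (mul_le_mul_right ((mul_le_mul_right h2 _).trans h1) _) _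
      _ = _ := by rw [mul_assoc 2]
  calc ∫⁻ x, centeredMaximal μ g x ^ p ∂μ
      = ∫⁻ t in Set.Ioi (0 : ℝ), ENNReal.ofReal (p * t ^ (p - 1)) *
          μ {x | ENNReal.ofReal t < centeredMaximal μ g x} := by
        simpa using lintegral_mul_rpow_eq_lintegral_lt μ (f := 1) measurable_one
          (measurable_centeredMaximal μ hg) (p := p) (by linarith)
    _ ≤ ∫⁻ t in Set.Ioi (0 : ℝ), (2 * N * ENNReal.ofReal (p / (p - 1))) *
          (ENNReal.ofReal ((p - 1) * t ^ (p - 1 - 1)) *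
            ∫⁻ x in {x | ENNReal.ofReal t < 2 * g x}, g x ∂μ) := by
        refine setLIntegral_mono' measurableSet_Ioi fun t ht => ?_
        rw [Set.mem_Ioi] at ht
        refine (mul_le_mul_right (hweak t ht) _).trans_eq ?_
        have : ENNReal.ofReal (p * t ^ (p - 1)) * ENNReal.ofReal t⁻¹ =
            ENNReal.ofReal (p / (p - 1)) * ENNReal.ofReal ((p - 1) * t ^ (p - 1 - 1)) := by
          have hp1 : 0 < p - 1 := by linarith
          rw [← ENNReal.ofReal_mul (by positivity), ← ENNReal.ofReal_mul (by positivity),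
            Real.rpow_sub_one ht.ne' (p - 1)]
          congr 1
          field_simp
        rw [← mul_assoc, this]
        ring
    _ = (2 * N * ENNReal.ofReal (p / (p - 1))) * ∫⁻ x, g x * (2 * g x) ^ (p - 1) ∂μ := by
        rw [lintegral_const_mul', lintegral_mul_rpow_eq_lintegral_lt μ hg h2g (by linarith)]
        exact ENNReal.mul_ne_top (by finiteness) ENNReal.ofReal_ne_top
    _ = _ := by
        have : ∀ x, g x * (2 * g x) ^ (p - 1) = 2 ^ (p - 1) * g x ^ p := by
          intro x
          rw [ENNReal.mul_rpow_of_nonneg _ _ (by linarith), mul_left_comm]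
          congr 1
          conv_rhs => rw [show p = 1 + (p - 1) by ring,
            ENNReal.rpow_add_of_nonneg _ _ zero_le_one (by linarith), ENNReal.rpow_one]
        simp_rw [this]
        rw [lintegral_const_mul' _ _ (by finiteness), ← mul_assoc]
        congr 1
        push_cast
        rw [ENNReal.coe_rpow_of_nonneg _ (by linarith)]
        rfl

end CenteredMaximal

theorem lintegral_le_rpow_mul_measure_rpow {E : Type*} [MeasurableSpace E] (μ : Measure E)
    {g : E → ℝ≥0∞} (hg : Measurable g) {P : ℝ} (hP : 1 ≤ P) (s : Set E) :
    ∫⁻ x in s, g x ∂μ ≤ (∫⁻ x, g x ^ P ∂μ) ^ (1 / P) * μ s ^ (1 - 1 / P) := by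
  have hP0 : 0 < P := by linarith
  have h := ENNReal.lintegral_mul_norm_pow_le (μ := μ.restrict s) (f := fun x => g x ^ P)
    (g := fun _ => 1) (hg.pow_const P).aemeasurable aemeasurable_const (p := 1 / P)
    (q := 1 - 1 / P) (by positivity) (by rw [sub_nonneg, div_le_one hP0]; exact hP) (by ring)
  simp only [ENNReal.one_rpow, mul_one, lintegral_const, Measure.restrict_apply_univ, one_mul,
    ← ENNReal.rpow_mul, mul_one_div_cancel hP0.ne', ENNReal.rpow_one] at h
  exact h.trans (by gcongr; exact Measure.restrict_le_self)

/-! ### Cubes and sup-norm balls -/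

namespace MultilinearFractional

section Cube

variable {n : ℕ}

theorem cube_eq_Icc (a : Fin n → ℝ) (ℓ : ℝ) : cube a ℓ = Set.Icc a (fun j => a j + ℓ) := by
  ext x
  simp [cube, Pi.le_def, forall_and]

theorem measurableSet_cube (a : Fin n → ℝ) (ℓ : ℝ) : MeasurableSet (cube a ℓ) := by
  rw [cube_eq_Icc]
  exact measurableSet_Icc

theorem volume_cube (a : Fin n → ℝ) (ℓ : ℝ) : volume (cube a ℓ) = ENNReal.ofReal ℓ ^ n := by
  rw [cube_eq_Icc, Real.volume_Icc_pi]
  simp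

theorem volume_cube_ne_zero (a : Fin n → ℝ) {ℓ : ℝ} (hℓ : 0 < ℓ) : volume (cube a ℓ) ≠ 0 := by
  rw [volume_cube]
  exact pow_ne_zero _ (by simpa using hℓ)

theorem volume_cube_ne_top (a : Fin n → ℝ) (ℓ : ℝ) : volume (cube a ℓ) ≠ ∞ := by
  rw [volume_cube]
  exact ENNReal.pow_ne_top ENNReal.ofReal_ne_top

theorem volume_cube_dilate (a b : Fin n → ℝ) {c ℓ : ℝ} (hc : 0 ≤ c) :
    volume (cube b (c * ℓ)) = ENNReal.ofReal c ^ n * volume (cube a ℓ) := by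
  rw [volume_cube, volume_cube, ENNReal.ofReal_mul hc, mul_pow]

theorem cube_subset_closedBall {a y : Fin n → ℝ} {ℓ r : ℝ} (hy : y ∈ cube a ℓ) (hℓ : 0 ≤ ℓ)
    (hr : ℓ ≤ r) : cube a ℓ ⊆ Metric.closedBall y r := by
  intro x hx
  rw [Metric.mem_closedBall, dist_pi_le_iff (hℓ.trans hr)]
  intro j
  rw [Real.dist_eq, abs_le]
  have := hx j
  have := hy j
  constructor <;> linarith

theorem closedBall_subset_cube {a y : Fin n → ℝ} {ℓ r : ℝ} (hy : y ∈ cube a ℓ) (hr0 : 0 ≤ r)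
    (hr : r ≤ 2 * ℓ) : Metric.closedBall y r ⊆ cube (fun j => a j - 2 * ℓ) (5 * ℓ) := by
  intro x hx j
  rw [Metric.mem_closedBall, dist_pi_le_iff hr0] at hx
  have h := hx j
  rw [Real.dist_eq, abs_le] at h
  have := hy j
  constructor <;> linarith

/-- A ball about `y` of rational radius between `ℓ` and `2 * ℓ` contains the cube and lies in its
concentric fivefold dilate. Normalising by the dilate avoids any doubling assumption on `μ`. -/
theorem setLIntegral_cube_le_centeredMaximal (μ : Measure (Fin n → ℝ)) (g : (Fin n → ℝ) → ℝ≥0∞)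
    {a y : Fin n → ℝ} {ℓ : ℝ} (hℓ : 0 < ℓ) (hy : y ∈ cube a ℓ) :
    (μ (cube (fun j => a j - 2 * ℓ) (5 * ℓ)))⁻¹ * ∫⁻ x in cube a ℓ, g x ∂μ ≤
      centeredMaximal μ g y := by
  obtain ⟨r, hr1, hr2⟩ := exists_rat_btwn (show ℓ < 2 * ℓ by linarith)
  have hr0 : (0 : ℝ) < r := hℓ.trans hr1
  refine le_trans ?_ (le_centeredMaximal μ g y (r := r) (by exact_mod_cast hr0))
  gcongr
  · exact closedBall_subset_cube hy hr0.le hr2.le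
  · exact cube_subset_closedBall hy hℓ.le hr1.le

end Cube

/-! ### Upper bound: exponents and Hölder inequalities -/

section Upper

variable {m : ℕ}

/-- The exponents in the proof of the upper bound: `s = m - α / n`, the number `π` is the power of
the weight constant (before taking `q`-th roots), and the fractional orders `r i` distribute
`α / n` among the factors. -/
structure ExponentData (P : Fin m → ℝ) (q s π : ℝ) (r : Fin m → ℝ) : Prop where
  one_lt_P : ∀ i, 1 < P i
  q_pos : 0 < q
  s_pos : 0 < s
  one_lt_pi : 1 < π
  r_nonneg : ∀ i, 0 ≤ r i
  r_lt : ∀ i, r i < 1 / P i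
  le_r : ∀ i, 1 - π * (1 - 1 / P i) ≤ r i
  sum_r : ∑ i, r i = m - s
  sum_conj : 1 / q + ∑ i, (1 - 1 / P i) = s

variable {P : Fin m → ℝ} {q s π : ℝ} {r : Fin m → ℝ}

theorem ExponentData.sum_eq_one (D : ExponentData P q s π r) :
    ∑ i, q * (1 / P i - r i) = 1 := by
  have h1 := D.sum_conj
  have h2 := D.sum_r
  have hq := D.q_pos
  rw [← Finset.mul_sum, Finset.sum_sub_distrib]
  rw [Finset.sum_sub_distrib] at h1
  simp only [Finset.sum_const, Finset.card_univ, Fintype.card_fin, nsmul_eq_mul, mul_one] at h1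
  have : ∑ i, 1 / P i - ∑ i, r i = 1 / q := by linarith
  rw [this]
  field_simp

/-- The function whose averages with respect to `v` dominate the multilinear averages
(multiplied by `v`). -/
noncomputable def auxDensity {E : Type*} (P : Fin m → ℝ) (q π : ℝ) (r : Fin m → ℝ)
    (σ : Fin m → E → ℝ≥0∞) (v H : E → ℝ≥0∞) (x : E) : ℝ≥0∞ :=
  (H x * v x ^ ((π - 1) / q) * ∏ i, σ i x ^ (1 / P i - r i)) ^ (q / π)

theorem measurable_auxDensity {E : Type*} [MeasurableSpace E] {σ : Fin m → E → ℝ≥0∞}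
    {v H : E → ℝ≥0∞} (hσ : ∀ i, Measurable (σ i)) (hv : Measurable v) (hH : Measurable H) :
    Measurable (auxDensity P q π r σ v H) :=
  ((hH.mul (hv.pow_const _)).mul
    (Finset.measurable_prod _ fun i _ => (hσ i).pow_const _)).pow_const _

/-- Insert the factor `1` of `hone` to the power `π - 1` and split its exponents: `1 / P i - r i` of
`σ i` goes into `auxDensity`, and `r i - 1 + π * (1 - 1 / P i)` is left over. The field `le_r` says
exactly that this remainder is nonnegative, as Hölder requires. -/
theorem holder_auxDensity (D : ExponentData P q s π r) {E : Type*} [MeasurableSpace E]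
    (μ : Measure E) {σ : Fin m → E → ℝ≥0∞} {v H : E → ℝ≥0∞} (hσ : ∀ i, Measurable (σ i))
    (hv : Measurable v) (hH : Measurable H) (h : ℝ≥0∞) (hhH : ∀ᵐ x ∂μ, h ≤ H x)
    (hone : ∀ᵐ x ∂μ, v x ^ (1 / q) * ∏ i, σ i x ^ (1 - 1 / P i) = 1) :
    μ Set.univ ^ (s * (π - 1)) * h ≤
      (∏ i, (∫⁻ x, σ i x ∂μ) ^ (r i - 1 + π * (1 - 1 / P i))) *
        (∫⁻ x, auxDensity P q π r σ v H x ∂μ) ^ (π / q) := by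
  have hκ : 0 < π - 1 := sub_pos.2 D.one_lt_pi
  have hπ : 0 < π := by linarith
  have hq := D.q_pos
  have hs := D.s_pos
  -- The total of `π / q` and all the leftover exponents, so division by `e` produces Hölder weights
  -- of sum `1`.
  set e := s * (π - 1) with he
  have he0 : 0 < e := by positivity
  have ht : ∀ i, 0 ≤ r i - 1 + π * (1 - 1 / P i) := fun i => by linarith [D.le_r i]
  have hsum : π / (q * e) + ∑ i, (r i - 1 + π * (1 - 1 / P i)) / e = 1 := by
    rw [← Finset.sum_div, Finset.sum_add_distrib, Finset.sum_sub_distrib, D.sum_r,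
      ← Finset.mul_sum]
    have : ∑ i, (1 - 1 / P i) = s - 1 / q := by linarith [D.sum_conj]
    rw [this]
    simp only [Finset.sum_const, Finset.card_univ, Fintype.card_fin, nsmul_eq_mul, mul_one]
    field_simp
    rw [he]
    ring
  have key := ENNReal.lintegral_mul_prod_norm_pow_le (μ := μ) Finset.univ
    (g := auxDensity P q π r σ v H) (f := σ) (measurable_auxDensity hσ hv hH).aemeasurable
    (fun i _ => (hσ i).aemeasurable) (q := π / (q * e))
    (p := fun i => (r i - 1 + π * (1 - 1 / P i)) / e) hsum (by positivity)
    (fun i _ => div_nonneg (ht i) he0.le)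
  have hpt : ∀ᵐ x ∂μ, h ^ (1 / e) ≤ auxDensity P q π r σ v H x ^ (π / (q * e)) *
      ∏ i, σ i x ^ ((r i - 1 + π * (1 - 1 / P i)) / e) := by
    filter_upwards [hhH, hone] with x hx h1
    have e1 : auxDensity P q π r σ v H x ^ (π / (q * e)) =
        (H x * v x ^ ((π - 1) / q) * ∏ i, σ i x ^ (1 / P i - r i)) ^ (1 / e) := by
      rw [auxDensity, ← ENNReal.rpow_mul]
      congr 1
      field_simp
    have e2 : ∏ i, σ i x ^ ((r i - 1 + π * (1 - 1 / P i)) / e) =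
        (∏ i, σ i x ^ (r i - 1 + π * (1 - 1 / P i))) ^ (1 / e) := by
      rw [← ENNReal.prod_rpow_of_nonneg (by positivity)]
      refine Finset.prod_congr rfl fun i _ => ?_
      rw [← ENNReal.rpow_mul, mul_one_div]
    have e3 : (∏ i, σ i x ^ (1 / P i - r i)) * ∏ i, σ i x ^ (r i - 1 + π * (1 - 1 / P i)) =
        (∏ i, σ i x ^ (1 - 1 / P i)) ^ (π - 1) := by
      rw [← Finset.prod_mul_distrib, ← ENNReal.prod_rpow_of_nonneg hκ.le]
      refine Finset.prod_congr rfl fun i _ => ?_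
      rw [← ENNReal.rpow_add_of_nonneg _ _ (by linarith [D.r_lt i]) (ht i), ← ENNReal.rpow_mul]
      congr 1
      ring
    have e4 : v x ^ ((π - 1) / q) = (v x ^ (1 / q)) ^ (π - 1) := by
      rw [← ENNReal.rpow_mul]
      congr 1
      ring
    rw [e1, e2, ← ENNReal.mul_rpow_of_nonneg _ _ (by positivity), mul_assoc, e3, mul_assoc, e4,
      ← ENNReal.mul_rpow_of_nonneg _ _ hκ.le, h1, ENNReal.one_rpow, mul_one]
    gcongr
  have h2 : h ^ (1 / e) * μ Set.univ ≤ (∫⁻ x, auxDensity P q π r σ v H x ∂μ) ^ (π / (q * e)) *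
      ∏ i, (∫⁻ x, σ i x ∂μ) ^ ((r i - 1 + π * (1 - 1 / P i)) / e) := by
    rw [← lintegral_const]
    exact (lintegral_mono_ae hpt).trans key
  have h3 := ENNReal.rpow_le_rpow h2 he0.le
  rw [ENNReal.mul_rpow_of_nonneg _ _ he0.le, ENNReal.mul_rpow_of_nonneg _ _ he0.le,
    ← ENNReal.rpow_mul, ← ENNReal.rpow_mul, one_div_mul_cancel he0.ne', ENNReal.rpow_one,
    ← ENNReal.prod_rpow_of_nonneg he0.le] at h3
  rw [mul_comm, mul_comm (∏ i, _)]
  refine h3.trans_eq ?_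
  congr 1
  · congr 1
    field_simp
  · refine Finset.prod_congr rfl fun i _ => ?_
    rw [← ENNReal.rpow_mul, div_mul_cancel₀ _ he0.ne']

/-- The powers of `v` cancel exactly, as `1 - π + (π - 1) = 0`, leaving `∏ (G i ^ P i * σ i) ^ (q *
(1 / P i - r i))`. These exponents sum to `1`, so Hölder applies. -/
theorem lintegral_auxDensity_rpow_le (D : ExponentData P q s π r) {E : Type*} [MeasurableSpace E]
    (μ : Measure E) {σ G : Fin m → E → ℝ≥0∞} {v : E → ℝ≥0∞} (hσ : ∀ i, Measurable (σ i))
    (hG : ∀ i, Measurable (G i)) (hv0 : ∀ᵐ x ∂μ, v x ≠ 0)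
    (hvtop : ∀ᵐ x ∂μ, v x ≠ ∞) :
    ∫⁻ x, v x * ((v x)⁻¹ * auxDensity P q π r σ v
        (fun x => ∏ i, G i x ^ (1 - r i * P i)) x) ^ π ∂μ ≤
      ∏ i, (∫⁻ x, G i x ^ P i * σ i x ∂μ) ^ (q * (1 / P i - r i)) := by
  have hq := D.q_pos
  have hπ : 0 < π := by linarith [D.one_lt_pi]
  have hP : ∀ i, 0 < P i := fun i => by linarith [D.one_lt_P i]
  refine le_trans (lintegral_mono_ae (g := fun x =>
    ∏ i, (G i x ^ P i * σ i x) ^ (q * (1 / P i - r i))) ?_)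
    (ENNReal.lintegral_prod_norm_pow_le Finset.univ
      (fun i _ => (((hG i).pow_const _).mul (hσ i)).aemeasurable) D.sum_eq_one
      (fun i _ => mul_nonneg hq.le (by linarith [D.r_lt i])))
  filter_upwards [hv0, hvtop] with x h0 h1
  refine le_of_eq ?_
  have e1 : auxDensity P q π r σ v (fun x => ∏ i, G i x ^ (1 - r i * P i)) x ^ π =
      v x ^ (π - 1) * ∏ i, (G i x ^ P i * σ i x) ^ (q * (1 / P i - r i)) := by
    rw [auxDensity, ← ENNReal.rpow_mul, div_mul_cancel₀ _ hπ.ne', mul_right_comm,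
      ENNReal.mul_rpow_of_nonneg _ _ hq.le, mul_comm, ← ENNReal.rpow_mul, div_mul_cancel₀ _ hq.ne',
      ← Finset.prod_mul_distrib, ← ENNReal.prod_rpow_of_nonneg hq.le]
    congr 1
    refine Finset.prod_congr rfl fun i _ => ?_
    have hri : 0 ≤ 1 / P i - r i := by linarith [D.r_lt i]
    rw [ENNReal.mul_rpow_of_nonneg _ _ hq.le, ENNReal.mul_rpow_of_nonneg _ _ (by positivity),
      ← ENNReal.rpow_mul, ← ENNReal.rpow_mul, ← ENNReal.rpow_mul]
    have := hP i
    congr 2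
    · field_simp
    · ring
  rw [ENNReal.mul_rpow_of_nonneg _ _ hπ.le, e1, ← mul_assoc, ← mul_assoc, ENNReal.inv_rpow,
    ← ENNReal.rpow_neg]
  have : v x * v x ^ (-π) * v x ^ (π - 1) = 1 := by
    conv_lhs => rw [← ENNReal.rpow_one (v x)]
    rw [← ENNReal.rpow_mul, ← ENNReal.rpow_mul, ← ENNReal.rpow_add _ _ h0 h1,
      ← ENNReal.rpow_add _ _ h0 h1]
    ring_nf
    simp
  rw [this, one_mul]

end Upper

end MultilinearFractional

/-! ### Upper bound: pointwise domination and strong type estimate -/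

namespace MultilinearFractional

section Upper

variable {n m : ℕ} {P : Fin m → ℝ} {q s π : ℝ} {r : Fin m → ℝ}

/-- Write the integral `I` as `I ^ (r * P) * I ^ (1 - r * P)`: Hölder bounds the first factor by the
global norm, and the second is kept as an average. The order `r` is this factor's share of `α / n`.
-/
theorem setLIntegral_le_of_rpow {E : Type*} [MeasurableSpace E] (μ : Measure E) {g : E → ℝ≥0∞}
    (hg : Measurable g) {P r : ℝ} (hP : 1 < P) (hr : 0 ≤ r) (hrP : r < 1 / P) {Q Q' : Set E}
    (hQ : Q ⊆ Q') (h0 : μ Q' ≠ 0) (htop : μ Q' ≠ ∞) :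
    ∫⁻ x in Q, g x ∂μ ≤ (∫⁻ x, g x ^ P ∂μ) ^ r * μ Q' ^ (1 - r) *
      ((μ Q')⁻¹ * ∫⁻ x in Q, g x ∂μ) ^ (1 - r * P) := by
  have hP0 : 0 < P := by linarith
  have hrP' : 0 ≤ 1 - r * P := by
    rw [lt_div_iff₀ hP0] at hrP
    linarith
  have hτ : 0 ≤ 1 - 1 / P := by
    rw [sub_nonneg, div_le_one hP0]
    exact hP.le
  set I := ∫⁻ x in Q, g x ∂μ with hI
  have h1 : I ≤ (∫⁻ x, g x ^ P ∂μ) ^ (1 / P) * μ Q' ^ (1 - 1 / P) :=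
    (lintegral_le_rpow_mul_measure_rpow μ hg hP.le Q).trans (by gcongr)
  calc I = I ^ (r * P) * (μ Q' * ((μ Q')⁻¹ * I)) ^ (1 - r * P) := by
        rw [← mul_assoc, ENNReal.mul_inv_cancel h0 htop, one_mul,
          ← ENNReal.rpow_add_of_nonneg _ _ (by positivity) hrP', add_sub_cancel, ENNReal.rpow_one]
    _ ≤ ((∫⁻ x, g x ^ P ∂μ) ^ (1 / P) * μ Q' ^ (1 - 1 / P)) ^ (r * P) *
          (μ Q' * ((μ Q')⁻¹ * I)) ^ (1 - r * P) := by gcongr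
    _ = _ := by
        rw [ENNReal.mul_rpow_of_nonneg _ _ (by positivity), ENNReal.mul_rpow_of_nonneg _ _ hrP',
          ← ENNReal.rpow_mul, ← ENNReal.rpow_mul, ← mul_assoc, mul_assoc (_ ^ (1 / P * (r * P))),
          ← ENNReal.rpow_add _ _ h0 htop]
        congr 3
        · field_simp
        · field_simp
          ring

/-- The pointwise domination of the multilinear averages over a cube `cube a ℓ` containing `x`. -/
theorem prod_average_le (D : ExponentData P q s π r) {σ g : Fin m → (Fin n → ℝ) → ℝ≥0∞}
    {v : (Fin n → ℝ) → ℝ≥0∞} (hσ : ∀ i, Measurable (σ i)) (hg : ∀ i, Measurable (g i))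
    (hv : Measurable v) (hv0 : ∀ᵐ x, v x ≠ 0) (hvtop : ∀ᵐ x, v x ≠ ∞)
    (hone : ∀ᵐ x, v x ^ (1 / q) * ∏ i, σ i x ^ (1 - 1 / P i) = 1) {K : ℝ≥0∞}
    {a x : Fin n → ℝ} {ℓ : ℝ} (hℓ : 0 < ℓ) (hx : x ∈ cube a ℓ)
    (hS0 : ∀ i, volume.withDensity (σ i) (cube (fun j => a j - 2 * ℓ) (5 * ℓ)) ≠ 0)
    (hStop : ∀ i, volume.withDensity (σ i) (cube (fun j => a j - 2 * ℓ) (5 * ℓ)) ≠ ∞)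
    (hV0 : volume.withDensity v (cube (fun j => a j - 2 * ℓ) (5 * ℓ)) ≠ 0)
    (hVtop : volume.withDensity v (cube (fun j => a j - 2 * ℓ) (5 * ℓ)) ≠ ∞)
    (hK : volume.withDensity v (cube (fun j => a j - 2 * ℓ) (5 * ℓ)) *
      ∏ i, volume.withDensity (σ i) (cube (fun j => a j - 2 * ℓ) (5 * ℓ)) ^ (q * (1 - 1 / P i)) ≤
        K * volume (cube (fun j => a j - 2 * ℓ) (5 * ℓ)) ^ (q * s)) :
    volume (cube a ℓ) ^ (-s) * ∏ i, ∫⁻ y in cube a ℓ, g i y ∂(volume.withDensity (σ i)) ≤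
      (5 ^ n) ^ (s * π) * K ^ (π / q) *
        (∏ i, (∫⁻ y, g i y ^ P i ∂(volume.withDensity (σ i))) ^ r i) *
        centeredMaximal (volume.withDensity v) (fun y => (v y)⁻¹ * auxDensity P q π r σ v
          (fun y => ∏ i, centeredMaximal (volume.withDensity (σ i)) (g i) y ^ (1 - r i * P i)) y) x
          ^ (π / q) := by
  have hq := D.q_pos
  have hs := D.s_pos
  have hπ : 0 < π := by linarith [D.one_lt_pi]
  set Q := cube a ℓ with hQ
  set Q' := cube (fun j => a j - 2 * ℓ) (5 * ℓ) with hQ'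
  have hQQ' : Q ⊆ Q' := by
    intro y hy j
    have := hy j
    constructor <;> linarith
  set μ : Fin m → Measure (Fin n → ℝ) := fun i => volume.withDensity (σ i) with hμ
  set ν : Measure (Fin n → ℝ) := volume.withDensity v with hν
  set H : (Fin n → ℝ) → ℝ≥0∞ :=
    fun y => ∏ i, centeredMaximal (μ i) (g i) y ^ (1 - r i * P i) with hH
  set F : (Fin n → ℝ) → ℝ≥0∞ := fun y => (v y)⁻¹ * auxDensity P q π r σ v H y with hF
  set A : Fin m → ℝ≥0∞ := fun i => (μ i Q')⁻¹ * ∫⁻ y in Q, g i y ∂(μ i) with hA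
  set h : ℝ≥0∞ := ∏ i, A i ^ (1 - r i * P i) with hh
  set W : Fin m → ℝ≥0∞ := fun i => ∫⁻ y, g i y ^ P i ∂(μ i) with hW
  set L := volume Q with hL
  have hL0 : L ≠ 0 := volume_cube_ne_zero a hℓ
  have hLtop : L ≠ ∞ := volume_cube_ne_top a ℓ
  have hrP : ∀ i, 0 ≤ 1 - r i * P i := fun i => by
    have := (lt_div_iff₀ (by linarith [D.one_lt_P i])).1 (D.r_lt i)
    linarith
  have hHm : Measurable H := Finset.measurable_prod _ fun i _ =>
    (measurable_centeredMaximal _ (hg i)).pow_const _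
  have hGm : Measurable (auxDensity P q π r σ v H) := measurable_auxDensity hσ hv hHm
  -- Each `A i` is at most the maximal function of `g i` at every point of `Q`, so `h ≤ H` there.
  -- The integral of `auxDensity` over `Q` is then read as a `v`-integral of `F` and compared with
  -- the maximal function at `x`.
  have hholder : L ^ (s * (π - 1)) * h ≤
      (∏ i, μ i Q' ^ (r i - 1 + π * (1 - 1 / P i))) *
        (ν Q' * centeredMaximal ν F x) ^ (π / q) := by
    have h1 := holder_auxDensity D (volume.restrict Q) hσ hv hHm h
      (by
        filter_upwards [ae_restrict_mem (measurableSet_cube a ℓ)] with y hy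
        exact Finset.prod_le_prod' fun i _ => ENNReal.rpow_le_rpow
          (setLIntegral_cube_le_centeredMaximal (μ i) (g i) hℓ hy) (hrP i))
      (ae_restrict_of_ae hone)
    rw [Measure.restrict_apply_univ] at h1
    refine h1.trans ?_
    gcongr with i
    · linarith [D.le_r i]
    · rw [← withDensity_apply _ (measurableSet_cube a ℓ)]
      exact measure_mono hQQ'
    · have h2 : ∫⁻ y in Q, auxDensity P q π r σ v H y = ∫⁻ y in Q, F y ∂ν := by
        have hFm : Measurable F := hv.inv.mul hGm
        rw [hν, setLIntegral_withDensity_eq_setLIntegral_mul _ hv hFm (measurableSet_cube a ℓ)]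
        refine lintegral_congr_ae (ae_restrict_of_ae ?_)
        filter_upwards [hv0, hvtop] with y h0 h1
        simp only [Pi.mul_apply, hF]
        rw [← mul_assoc, ENNReal.mul_inv_cancel h0 h1, one_mul]
      rw [h2]
      calc ∫⁻ y in Q, F y ∂ν = ν Q' * ((ν Q')⁻¹ * ∫⁻ y in Q, F y ∂ν) := by
            rw [← mul_assoc, ENNReal.mul_inv_cancel hV0 hVtop, one_mul]
        _ ≤ _ := by
            gcongr
            exact setLIntegral_cube_le_centeredMaximal ν F hℓ hx
  -- The weight condition on `Q'` to the power `π / q`; the factor `5 ^ n` is the ratio of the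
  -- volumes of `Q'` and `Q`.
  have hK' : (∏ i, μ i Q' ^ (π * (1 - 1 / P i))) * ν Q' ^ (π / q) ≤
      K ^ (π / q) * ((5 ^ n) ^ (s * π) * L ^ (s * π)) := by
    have h1 := ENNReal.rpow_le_rpow hK (z := π / q) (by positivity)
    rw [ENNReal.mul_rpow_of_nonneg _ _ (by positivity),
      ENNReal.mul_rpow_of_nonneg _ _ (by positivity),
      ← ENNReal.prod_rpow_of_nonneg (by positivity), ← ENNReal.rpow_mul,
      hQ', volume_cube_dilate a _ (by norm_num : (0 : ℝ) ≤ 5)] at h1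
    rw [← ENNReal.mul_rpow_of_nonneg _ _ (by positivity)]
    convert h1 using 1
    · rw [mul_comm]
      congr 1
      refine Finset.prod_congr rfl fun i _ => ?_
      rw [← ENNReal.rpow_mul]
      congr 1
      field_simp
    · congr 2
      · rw [hL, hQ, ENNReal.ofReal_ofNat]
      · field_simp
  have hexp : ∏ i, μ i Q' ^ (π * (1 - 1 / P i)) =
      (∏ i, μ i Q' ^ (1 - r i)) * ∏ i, μ i Q' ^ (r i - 1 + π * (1 - 1 / P i)) := by
    rw [← Finset.prod_mul_distrib]
    refine Finset.prod_congr rfl fun i _ => ?_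
    rw [← ENNReal.rpow_add _ _ (hS0 i) (hStop i)]
    congr 1
    ring
  have hLpow : L ^ (-s) = L ^ (-(s * π)) * L ^ (s * (π - 1)) := by
    rw [← ENNReal.rpow_add _ _ hL0 hLtop]
    congr 1
    ring
  calc L ^ (-s) * ∏ i, ∫⁻ y in Q, g i y ∂(μ i)
      ≤ L ^ (-s) * ∏ i, (W i ^ r i * μ i Q' ^ (1 - r i) * A i ^ (1 - r i * P i)) := by
        gcongr with i
        exact setLIntegral_le_of_rpow (μ i) (hg i) (D.one_lt_P i) (D.r_nonneg i) (D.r_lt i) hQQ'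
          (hS0 i) (hStop i)
    _ = (∏ i, W i ^ r i) * L ^ (-(s * π)) * (∏ i, μ i Q' ^ (1 - r i)) *
          (L ^ (s * (π - 1)) * h) := by
        rw [Finset.prod_mul_distrib, Finset.prod_mul_distrib, hLpow]
        ring
    _ ≤ (∏ i, W i ^ r i) * L ^ (-(s * π)) * (∏ i, μ i Q' ^ (1 - r i)) *
          ((∏ i, μ i Q' ^ (r i - 1 + π * (1 - 1 / P i))) *
            (ν Q' * centeredMaximal ν F x) ^ (π / q)) := by gcongr
    _ = (∏ i, W i ^ r i) * L ^ (-(s * π)) * ((∏ i, μ i Q' ^ (π * (1 - 1 / P i))) *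
          ν Q' ^ (π / q)) * centeredMaximal ν F x ^ (π / q) := by
        rw [hexp, ENNReal.mul_rpow_of_nonneg _ _ (by positivity)]
        ring
    _ ≤ (∏ i, W i ^ r i) * L ^ (-(s * π)) * (K ^ (π / q) * ((5 ^ n) ^ (s * π) * L ^ (s * π))) *
          centeredMaximal ν F x ^ (π / q) := by gcongr
    _ = (L ^ (-(s * π)) * L ^ (s * π)) * ((5 ^ n) ^ (s * π) * K ^ (π / q) * (∏ i, W i ^ r i) *
          centeredMaximal ν F x ^ (π / q)) := by ring
    _ = _ := by
        rw [← ENNReal.rpow_add _ _ hL0 hLtop, neg_add_cancel, ENNReal.rpow_zero, one_mul]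

/-- The strong type bound for an abstract operator satisfying the pointwise domination. -/
theorem exists_lintegral_rpow_le (n : ℕ) (D : ExponentData P q s π r) :
    ∃ C : ℝ≥0, ∀ (σ g : Fin m → (Fin n → ℝ) → ℝ≥0∞) (v T : (Fin n → ℝ) → ℝ≥0∞) (K : ℝ≥0∞),
      (∀ i, Measurable (σ i)) → (∀ i, Measurable (g i)) → Measurable v →
      (∀ᵐ x, v x ≠ 0) → (∀ᵐ x, v x ≠ ∞) →
      (∀ x, T x ≤ (5 ^ n) ^ (s * π) * K ^ (π / q) *
        (∏ i, (∫⁻ y, g i y ^ P i ∂(volume.withDensity (σ i))) ^ r i) *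
        centeredMaximal (volume.withDensity v) (fun y => (v y)⁻¹ * auxDensity P q π r σ v
          (fun y => ∏ i, centeredMaximal (volume.withDensity (σ i)) (g i) y ^ (1 - r i * P i)) y) x
          ^ (π / q)) →
      ∫⁻ x, T x ^ q ∂(volume.withDensity v) ≤ C * K ^ π *
        ∏ i, (∫⁻ y, g i y ^ P i ∂(volume.withDensity (σ i))) ^ (q / P i) := by
  have hq := D.q_pos
  have hs := D.s_pos
  have hπ : 0 < π := by linarith [D.one_lt_pi]
  obtain ⟨C₀, hC₀⟩ := exists_centeredMaximal_strongType (Fin n → ℝ) D.one_lt_pi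
  choose C hC using fun i => exists_centeredMaximal_strongType (Fin n → ℝ) (D.one_lt_P i)
  have hr : ∀ i, 0 ≤ q * (1 / P i - r i) := fun i =>
    mul_nonneg hq.le (by linarith [D.r_lt i])
  refine ⟨(5 ^ n) ^ (s * π * q) * C₀ * ∏ i, C i ^ (q * (1 / P i - r i)),
    fun σ g v T K hσ hg hv hv0 hvtop hT => ?_⟩
  set μ : Fin m → Measure (Fin n → ℝ) := fun i => volume.withDensity (σ i) with hμ
  set ν : Measure (Fin n → ℝ) := volume.withDensity v with hν
  set F : (Fin n → ℝ) → ℝ≥0∞ := fun y => (v y)⁻¹ * auxDensity P q π r σ v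
    (fun y => ∏ i, centeredMaximal (μ i) (g i) y ^ (1 - r i * P i)) y with hF
  set W : Fin m → ℝ≥0∞ := fun i => ∫⁻ y, g i y ^ P i ∂(μ i) with hW
  have hFm : Measurable F := hv.inv.mul (measurable_auxDensity hσ hv
    (Finset.measurable_prod _ fun i _ => (measurable_centeredMaximal _ (hg i)).pow_const _))
  have hFint : ∫⁻ x, F x ^ π ∂ν ≤ ∏ i, (C i * W i) ^ (q * (1 / P i - r i)) := by
    rw [hν, lintegral_withDensity_eq_lintegral_mul _ hv (hFm.pow_const π)]
    refine (lintegral_auxDensity_rpow_le D volume hσ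
      (fun i => measurable_centeredMaximal (μ i) (hg i)) hv0 hvtop).trans ?_
    refine Finset.prod_le_prod' fun i _ => ENNReal.rpow_le_rpow ?_ (hr i)
    refine le_trans (le_of_eq ?_) (hC i (μ i) (g i) (hg i))
    rw [hμ, lintegral_withDensity_eq_lintegral_mul _ (hσ i)
      ((measurable_centeredMaximal _ (hg i)).pow_const _)]
    congr 1 with x
    rw [mul_comm]
    rfl
  set B := (5 ^ n) ^ (s * π) * K ^ (π / q) * ∏ i, W i ^ r i with hB
  have hBq : B ^ q = (5 ^ n) ^ (s * π * q) * K ^ π * ∏ i, W i ^ (r i * q) := by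
    rw [hB, ENNReal.mul_rpow_of_nonneg _ _ hq.le, ENNReal.mul_rpow_of_nonneg _ _ hq.le,
      ← ENNReal.rpow_mul, ← ENNReal.rpow_mul, div_mul_cancel₀ _ hq.ne',
      ← ENNReal.prod_rpow_of_nonneg hq.le]
    simp_rw [← ENNReal.rpow_mul]
  calc ∫⁻ x, T x ^ q ∂ν ≤ ∫⁻ x, B ^ q * centeredMaximal ν F x ^ π ∂ν := by
        refine lintegral_mono fun x => ?_
        refine (ENNReal.rpow_le_rpow (hT x) hq.le).trans_eq ?_
        rw [ENNReal.mul_rpow_of_nonneg _ _ hq.le, ← ENNReal.rpow_mul, div_mul_cancel₀ _ hq.ne']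
    _ = B ^ q * ∫⁻ x, centeredMaximal ν F x ^ π ∂ν :=
        lintegral_const_mul _ ((measurable_centeredMaximal ν hFm).pow_const _)
    _ ≤ B ^ q * (C₀ * ∏ i, (C i * W i) ^ (q * (1 / P i - r i))) := by
        gcongr
        exact (hC₀ ν F hFm).trans (by gcongr)
    _ = _ := by
        -- The norms enter twice, with exponent `r i * q` through `B` and `q * (1 / P i - r i)`
        -- through `F`; together this is `q / P i`.
        have e1 : ∏ i, W i ^ (q / P i) =
            (∏ i, W i ^ (r i * q)) * ∏ i, W i ^ (q * (1 / P i - r i)) := by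
          rw [← Finset.prod_mul_distrib]
          refine Finset.prod_congr rfl fun i _ => ?_
          rw [← ENNReal.rpow_add_of_nonneg _ _ (mul_nonneg (D.r_nonneg i) hq.le) (hr i)]
          congr 1
          ring
        have e2 : ∏ i, ((C i : ℝ≥0∞) * W i) ^ (q * (1 / P i - r i)) =
            (∏ i, (C i : ℝ≥0∞) ^ (q * (1 / P i - r i))) * ∏ i, W i ^ (q * (1 / P i - r i)) := by
          rw [← Finset.prod_mul_distrib]
          exact Finset.prod_congr rfl fun i _ => ENNReal.mul_rpow_of_nonneg _ _ (hr i)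
        rw [hBq, e1, e2]
        push_cast
        rw [ENNReal.coe_rpow_of_nonneg _ (by positivity),
          Finset.prod_congr rfl fun i _ => ENNReal.coe_rpow_of_nonneg (C i) (hr i)]
        push_cast
        ring

end Upper

end MultilinearFractional

/-! ### Choice of the fractional orders -/

theorem Real.inv_conjExponent_eq {P : ℝ} (hP : 1 < P) : P.conjExponent⁻¹ = 1 - 1 / P := by
  have : P - 1 ≠ 0 := by linarith
  rw [Real.conjExponent, inv_div, sub_div, div_self (by linarith)]

theorem ENNReal.prod_rpow_eq_rpow_sum {ι : Type*} (s : Finset ι) {x : ℝ≥0∞} (h0 : x ≠ 0)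
    (htop : x ≠ ∞) (f : ι → ℝ) : ∏ i ∈ s, x ^ f i = x ^ ∑ i ∈ s, f i := by
  classical
  induction s using Finset.induction_on with
  | empty => simp
  | insert i s hi ih =>
    rw [Finset.prod_insert hi, Finset.sum_insert hi, ih, ENNReal.rpow_add _ _ h0 htop]

theorem exists_between_sum_eq {ι : Type*} [Fintype ι] {b c : ι → ℝ} (hbc : ∀ i, b i < c i) {A : ℝ}
    (hb : ∑ i, b i ≤ A) (hc : A < ∑ i, c i) :
    ∃ r : ι → ℝ, (∀ i, b i ≤ r i) ∧ (∀ i, r i < c i) ∧ ∑ i, r i = A := by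
  set t := (A - ∑ i, b i) / (∑ i, c i - ∑ i, b i) with ht
  have hd : 0 < ∑ i, c i - ∑ i, b i := by linarith
  have ht0 : 0 ≤ t := div_nonneg (by linarith) hd.le
  have ht1 : t < 1 := (div_lt_one hd).2 (by linarith)
  refine ⟨fun i => b i + t * (c i - b i), fun i => ?_, fun i => ?_, ?_⟩
  · have := mul_nonneg ht0 (sub_nonneg.2 (hbc i).le)
    linarith
  · have := mul_lt_mul_of_pos_right ht1 (sub_pos.2 (hbc i))
    linarith
  · rw [Finset.sum_add_distrib, ← Finset.mul_sum, Finset.sum_sub_distrib, ht,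
      div_mul_cancel₀ _ hd.ne']
    ring

namespace MultilinearFractional

variable {n m : ℕ}

/-- Since `max P' * (1 - 1 / P i) ≥ 1`, each lower constraint on `r i` is at most `α / (n * m)`, so
these sum to at most `α / n`. The upper constraints `1 / P i` sum to `1 / p > α / n`. Hence a point
between them has sum exactly `α / n`. -/
theorem exists_exponentData (hn : 0 < n) (hm : 0 < m) {P : Fin m → ℝ} {p q α : ℝ}
    (hP : ∀ i, 1 < P i) (hp : 1 / p = ∑ i, 1 / P i) (hα : 0 < α) (hαmn : α < (m : ℝ) * n)
    (hp0 : 0 < p) (hpα : p < n / α) (hq : 1 / q = 1 / p - α / n) :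
    ∃ r, ExponentData P q (m - α / n)
      ((1 - α / ((m : ℝ) * n)) * ⨆ i, (P i).conjExponent) r := by
  have hn' : (0 : ℝ) < n := by exact_mod_cast hn
  have hm' : (0 : ℝ) < m := by exact_mod_cast hm
  have : Nonempty (Fin m) := ⟨⟨0, hm⟩⟩
  have hαp : α / n < 1 / p := by
    rw [lt_div_iff₀ hα] at hpα
    rw [div_lt_div_iff₀ hn' hp0]
    linarith
  set θ := 1 - α / ((m : ℝ) * n) with hθ
  have hθ1 : 1 - θ = α / n / m := by
    rw [hθ]
    field_simp
    ring
  have hθ0 : 0 < θ := by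
    rw [hθ, sub_pos, div_lt_one (by positivity)]
    exact hαmn
  set M := ⨆ i, (P i).conjExponent with hM
  have hMi : ∀ i, (P i).conjExponent ≤ M := fun i => le_ciSup (f := fun i => (P i).conjExponent) (Set.finite_range _).bddAbove i
  have hci : ∀ i, 0 < (P i).conjExponent := fun i => (Real.HolderConjugate.conjExponent (hP i)).symm.pos
  have hτ : ∀ i, 0 < 1 - 1 / P i := fun i => by
    rw [← Real.inv_conjExponent_eq (hP i)]
    exact inv_pos.2 (hci i)
  have hMτ : ∀ i, 1 ≤ M * (1 - 1 / P i) := fun i => by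
    rw [← Real.inv_conjExponent_eq (hP i), ← div_eq_mul_inv, one_le_div (hci i)]
    exact hMi i
  have hM0 : 0 < M := (hci (Classical.arbitrary _)).trans_le (hMi _)
  -- Otherwise every `1 / P i` is at most `α / (n * m)`, and summing contradicts `α / n < 1 / p`.
  have hπ : 1 < θ * M := by
    by_contra hcon
    rw [not_lt] at hcon
    have h1 : ∀ i, 1 / P i ≤ α / n / m := fun i => by
      have h2 : θ ≤ 1 - 1 / P i := by
        by_contra h3
        rw [not_le] at h3
        have := mul_lt_mul_of_pos_left h3 hM0
        have := hMτ i
        linarith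
      linarith
    have h2 := Finset.sum_le_card_nsmul Finset.univ _ _ fun i _ => h1 i
    rw [← hp] at h2
    simp only [Finset.card_univ, Fintype.card_fin, nsmul_eq_mul] at h2
    rw [mul_div_cancel₀ _ hm'.ne'] at h2
    linarith
  have hbc : ∀ i, max 0 (1 - θ * M * (1 - 1 / P i)) < 1 / P i := fun i => by
    refine max_lt (by have := hP i; positivity) ?_
    have := mul_lt_mul_of_pos_right hπ (hτ i)
    linarith
  have hbA : ∑ i, max 0 (1 - θ * M * (1 - 1 / P i)) ≤ α / n := by
    have h2 := Finset.sum_le_card_nsmul Finset.univ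
      (fun i => max 0 (1 - θ * M * (1 - 1 / P i))) (α / n / m) fun i _ => by
        refine max_le (by positivity) ?_
        have := mul_le_mul_of_nonneg_left (hMτ i) hθ0.le
        rw [← hθ1]
        linarith
    simp only [Finset.card_univ, Fintype.card_fin, nsmul_eq_mul] at h2
    rwa [mul_div_cancel₀ _ hm'.ne'] at h2
  obtain ⟨r, hr1, hr2, hr3⟩ := exists_between_sum_eq hbc hbA (by rw [← hp]; exact hαp)
  have hq0 : 0 < q := by
    rw [← one_div_pos, hq]
    linarith
  refine ⟨r, hP, hq0, ?_, hπ, fun i => (le_max_left _ _).trans (hr1 i), hr2,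
    fun i => (le_max_right _ _).trans (hr1 i), by rw [hr3]; ring, ?_⟩
  · have : α / n < m := by
      rw [div_lt_iff₀ hn']
      exact hαmn
    linarith
  · rw [Finset.sum_sub_distrib, ← hp, hq]
    simp only [Finset.sum_const, Finset.card_univ, Fintype.card_fin, nsmul_eq_mul, mul_one]
    ring

/-! ### Almost everywhere invariance and nondegeneracy of weights -/

theorem fracMaximal_congr_ae (α : ℝ) {f f' : Fin m → (Fin n → ℝ) → ℂ}
    (h : ∀ i, f i =ᵐ[volume] f' i) : fracMaximal α f = fracMaximal α f' := by
  have : ∀ i a ℓ, ∫⁻ y in cube a ℓ, ‖f i y‖ₑ = ∫⁻ y in cube a ℓ, ‖f' i y‖ₑ := fun i a ℓ =>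
    lintegral_congr_ae (ae_restrict_of_ae (by filter_upwards [h i] with y hy; rw [hy]))
  ext x
  simp only [fracMaximal, this]

theorem prodWeight_congr_ae {ω ω' : Fin m → (Fin n → ℝ) → ℝ≥0}
    (h : ∀ i, ω i =ᵐ[volume] ω' i) : prodWeight ω =ᵐ[volume] prodWeight ω' := by
  filter_upwards [ae_all_iff.2 h] with x hx
  simp [prodWeight, hx]

theorem weightConst_congr_ae (P : Fin m → ℝ) (q : ℝ) {ω ω' : Fin m → (Fin n → ℝ) → ℝ≥0}
    (h : ∀ i, ω i =ᵐ[volume] ω' i) : weightConst P q ω = weightConst P q ω' := by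
  have h1 : ∀ a ℓ, ⨍⁻ x in cube a ℓ, prodWeight ω x ^ q ∂volume =
      ⨍⁻ x in cube a ℓ, prodWeight ω' x ^ q ∂volume := fun a ℓ =>
    laverage_congr (ae_restrict_of_ae (by
      filter_upwards [prodWeight_congr_ae h] with y hy; rw [hy]))
  have h2 : ∀ i a ℓ, ⨍⁻ x in cube a ℓ, (ω i x : ℝ≥0∞) ^ (-(P i).conjExponent) ∂volume =
      ⨍⁻ x in cube a ℓ, (ω' i x : ℝ≥0∞) ^ (-(P i).conjExponent) ∂volume := fun i a ℓ =>
    laverage_congr (ae_restrict_of_ae (by filter_upwards [h i] with y hy; rw [hy]))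
  simp only [weightConst, h1, h2]

theorem measurable_prodWeight {ω : Fin m → (Fin n → ℝ) → ℝ≥0} (hω : ∀ i, Measurable (ω i)) :
    Measurable (prodWeight ω) :=
  Finset.measurable_prod _ fun i _ => (hω i).coe_nnreal_ennreal

theorem le_weightConst (P : Fin m → ℝ) (q : ℝ) (ω : Fin m → (Fin n → ℝ) → ℝ≥0)
    (a : Fin n → ℝ) {ℓ : ℝ} (hℓ : 0 < ℓ) :
    (⨍⁻ x in cube a ℓ, prodWeight ω x ^ q ∂volume) *
      ∏ i, (⨍⁻ x in cube a ℓ, (ω i x : ℝ≥0∞) ^ (-(P i).conjExponent) ∂volume) ^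
        (q / (P i).conjExponent) ≤ weightConst P q ω :=
  le_iSup_of_le a (le_iSup_of_le ℓ (le_iSup_of_le hℓ le_rfl))

theorem lintegral_mul_prod_le_weightConst {P : Fin m → ℝ} {q s : ℝ} (hP : ∀ i, 1 < P i)
    (hq : 0 < q) (hs : 1 / q + ∑ i, (1 - 1 / P i) = s) (ω : Fin m → (Fin n → ℝ) → ℝ≥0)
    (a : Fin n → ℝ) {ℓ : ℝ} (hℓ : 0 < ℓ) :
    (∫⁻ x in cube a ℓ, prodWeight ω x ^ q) *
      ∏ i, (∫⁻ x in cube a ℓ, (ω i x : ℝ≥0∞) ^ (-(P i).conjExponent)) ^ (q * (1 - 1 / P i)) ≤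
    weightConst P q ω * volume (cube a ℓ) ^ (q * s) := by
  have hL0 := volume_cube_ne_zero a hℓ
  have hLtop := volume_cube_ne_top a ℓ
  set L := volume (cube a ℓ)
  have hτ : ∀ i, 0 ≤ q * (1 - 1 / P i) := fun i => by
    have := hP i
    exact mul_nonneg hq.le (sub_nonneg.2 ((div_le_one (by linarith)).2 this.le))
  have e : L ^ (q * s) = L * ∏ i, L ^ (q * (1 - 1 / P i)) := by
    rw [ENNReal.prod_rpow_eq_rpow_sum _ hL0 hLtop, ← Finset.mul_sum]
    nth_rw 2 [← ENNReal.rpow_one L]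
    rw [← ENNReal.rpow_add _ _ hL0 hLtop, ← hs, mul_add, mul_one_div_cancel hq.ne']
  have key := le_weightConst P q ω a hℓ
  simp only [setLAverage_eq, div_eq_mul_inv q, Real.inv_conjExponent_eq (hP _)] at key
  refine le_trans (le_of_eq ?_) (mul_le_mul_left key _)
  rw [e, mul_mul_mul_comm, ENNReal.div_mul_cancel hL0 hLtop, ← Finset.prod_mul_distrib]
  congr 1
  refine Finset.prod_congr rfl fun i _ => ?_
  rw [← ENNReal.mul_rpow_of_nonneg _ _ (hτ i), ENNReal.div_mul_cancel hL0 hLtop]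

/-- If `ω i` vanished on a set of positive measure, a large cube would meet both that set and the
set where the product weight is nonzero in positive measure. There the average of `ω i ^ (-P i')` is
`∞` and all other factors are positive, so the constant is infinite. A null product weight must be
excluded because `0 * ∞ = 0`. -/
theorem weight_ae_ne_zero {P : Fin m → ℝ} {q : ℝ} (hP : ∀ i, 1 < P i)
    (hq : 0 < q) {ω : Fin m → (Fin n → ℝ) → ℝ≥0} (hω : ∀ i, Measurable (ω i))
    (hK : weightConst P q ω ≠ ∞) (hν : ¬ prodWeight ω =ᵐ[volume] 0) (i : Fin m) :
    ∀ᵐ x, ω i x ≠ 0 := by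
  by_contra hcon
  let Q : ℕ → Set (Fin n → ℝ) := fun k => cube (fun _ => -(k + 1 : ℝ)) (2 * (k + 1))
  have hQmono : Monotone Q := by
    intro k l hkl x hx j
    have h1 := hx j
    have h2 : (k : ℝ) ≤ l := by exact_mod_cast hkl
    constructor <;> linarith
  have hQuniv : ⋃ k, Q k = Set.univ := by
    refine Set.eq_univ_of_forall fun x => ?_
    obtain ⟨k, hk⟩ := exists_nat_ge ‖x‖
    refine Set.mem_iUnion.2 ⟨k, fun j => ?_⟩
    have h1 := abs_le.1 ((Real.norm_eq_abs _).symm.le.trans ((norm_le_pi_norm x j).trans hk))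
    constructor <;> linarith
  have hpos : ∀ S : Set (Fin n → ℝ), volume S ≠ 0 → ∃ k, volume (S ∩ Q k) ≠ 0 := by
    intro S hS
    by_contra! h
    refine hS ?_
    rw [← Set.inter_univ S, ← hQuniv, Set.inter_iUnion]
    exact measure_iUnion_null h
  obtain ⟨k, hk⟩ := hpos {x | ω i x = 0} (by simpa [ae_iff] using hcon)
  obtain ⟨l, hl⟩ := hpos {x | prodWeight ω x ≠ 0} (by
    intro h
    exact hν (by rw [Filter.EventuallyEq, ae_iff]; exact h))
  set R := Q (max k l) with hR
  have hk' : volume ({x | ω i x = 0} ∩ R) ≠ 0 := fun h => hk (measure_mono_null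
    (Set.inter_subset_inter_right _ (hQmono (le_max_left _ _))) h)
  have hl' : volume ({x | prodWeight ω x ≠ 0} ∩ R) ≠ 0 := fun h => hl (measure_mono_null
    (Set.inter_subset_inter_right _ (hQmono (le_max_right _ _))) h)
  have hc : ∀ j, 0 < (P j).conjExponent := fun j =>
    (Real.HolderConjugate.conjExponent (hP j)).symm.pos
  have hℓ : (0 : ℝ) < 2 * ((max k l : ℕ) + 1) := by positivity
  have hRm : MeasurableSet R := measurableSet_cube _ _
  have hR0 : volume R ≠ 0 := volume_cube_ne_zero _ hℓ
  have hRtop : volume R ≠ ∞ := volume_cube_ne_top _ _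
  have hσm : ∀ j, Measurable fun x => (ω j x : ℝ≥0∞) ^ (-(P j).conjExponent) := fun j =>
    (hω j).coe_nnreal_ennreal.pow_const _
  refine hK (top_le_iff.1 (le_trans (le_of_eq ?_) (le_weightConst P q ω
    (fun _ => -((max k l : ℕ) + 1 : ℝ)) hℓ)))
  change ∞ = (⨍⁻ x in R, prodWeight ω x ^ q ∂volume) *
      ∏ i, (⨍⁻ x in R, (ω i x : ℝ≥0∞) ^ (-(P i).conjExponent) ∂volume) ^
        (q / (P i).conjExponent)
  simp only [setLAverage_eq]
  have h1 : (∫⁻ x in R, prodWeight ω x ^ q) / volume R ≠ 0 := by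
    rw [Ne, ENNReal.div_eq_zero_iff, not_or]
    refine ⟨?_, hRtop⟩
    rw [setLIntegral_eq_zero_iff hRm ((measurable_prodWeight hω).pow_const q), ae_iff]
    intro h
    refine hl' (measure_mono_null ?_ h)
    rintro x ⟨hx, hxR⟩
    simp only [Set.mem_ofPred_eq, Classical.not_imp]
    exact ⟨hxR, fun h0 => hx ((ENNReal.rpow_eq_zero_iff_of_pos hq).1 h0)⟩
  have h2 : ∀ j, (∫⁻ x in R, (ω j x : ℝ≥0∞) ^ (-(P j).conjExponent)) / volume R ≠ 0 := by
    intro j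
    rw [Ne, ENNReal.div_eq_zero_iff, not_or]
    refine ⟨?_, hRtop⟩
    rw [setLIntegral_eq_zero_iff hRm (hσm j), ae_iff]
    intro h
    refine hR0 (measure_mono_null ?_ h)
    intro x hxR
    simp only [Set.mem_ofPred_eq, Classical.not_imp]
    refine ⟨hxR, fun h0 => ?_⟩
    rw [ENNReal.rpow_eq_zero_iff] at h0
    have := hc j
    rcases h0 with h0 | h0
    · linarith [h0.2]
    · exact ENNReal.coe_ne_top h0.1
  have h3 : (∫⁻ x in R, (ω i x : ℝ≥0∞) ^ (-(P i).conjExponent)) / volume R = ∞ := by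
    rw [ENNReal.div_eq_top]
    refine .inr ⟨?_, hRtop⟩
    have h4 : ∫⁻ x in {x | ω i x = 0} ∩ R, (ω i x : ℝ≥0∞) ^ (-(P i).conjExponent) = ∞ := by
      have hzm : MeasurableSet {x | ω i x = 0} := hω i (measurableSet_singleton 0)
      rw [setLIntegral_congr_fun (g := fun _ => ∞) (hzm.inter hRm)]
      · rw [setLIntegral_const, ENNReal.top_mul hk']
      · rintro x ⟨hx, -⟩
        have hx' : ω i x = 0 := hx
        simp [hx', ENNReal.zero_rpow_of_neg (neg_lt_zero.2 (hc i))]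
    exact top_le_iff.1 (h4.symm.le.trans (lintegral_mono_set Set.inter_subset_right))
  symm
  rw [ENNReal.mul_eq_top]
  refine .inl ⟨h1, ?_⟩
  rw [← Finset.mul_prod_erase _ _ (Finset.mem_univ i), h3,
    ENNReal.top_rpow_of_pos (div_pos hq (hc i)), ENNReal.top_mul]
  rw [Finset.prod_ne_zero_iff]
  intro j _ h0
  exact h2 j ((ENNReal.rpow_eq_zero_iff_of_pos (div_pos hq (hc j))).1 h0)

end MultilinearFractional

/-! ### Upper bound: admissibility of the power -/

theorem eLpNorm_ofReal_eq_lintegral {X ε : Type*} [MeasurableSpace X] [ENorm ε] (f : X → ε)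
    (μ : Measure X) {q : ℝ} (hq : 0 < q) :
    eLpNorm f (ENNReal.ofReal q) μ = (∫⁻ x, ‖f x‖ₑ ^ q ∂μ) ^ (1 / q) := by
  rw [eLpNorm_eq_lintegral_rpow_enorm_toReal (by simpa using hq) ENNReal.ofReal_ne_top,
    ENNReal.toReal_ofReal hq.le]

theorem withDensity_apply_ne_zero {X : Type*} [MeasurableSpace X] {μ : Measure X} {v : X → ℝ≥0∞}
    (hv : Measurable v) (hv0 : ∀ᵐ x ∂μ, v x ≠ 0) {s : Set X} (hs : MeasurableSet s)
    (hs0 : μ s ≠ 0) : μ.withDensity v s ≠ 0 := by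
  rw [withDensity_apply _ hs]
  intro h
  rw [setLIntegral_eq_zero_iff hs hv] at h
  refine hs0 (measure_mono_null (fun x hx => ?_) (ae_iff.1 (hv0.and h)))
  simp only [Set.mem_ofPred_eq]
  exact fun h => h.1 (h.2 hx)

namespace MultilinearFractional

variable {n m : ℕ} {P : Fin m → ℝ} {q s π α : ℝ} {r : Fin m → ℝ}

theorem prod_average_eq (hm : 0 < m) (hn : 0 < n) (α : ℝ) (a : Fin n → ℝ) {ℓ : ℝ} (hℓ : 0 < ℓ)
    (I : Fin m → ℝ≥0∞) :
    ∏ i, (volume (cube a ℓ) ^ (1 - α / ((m : ℝ) * n)))⁻¹ * I i =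
      volume (cube a ℓ) ^ (-(m - α / n)) * ∏ i, I i := by
  have hn' : (n : ℝ) ≠ 0 := by exact_mod_cast hn.ne'
  have hm' : (m : ℝ) ≠ 0 := by exact_mod_cast hm.ne'
  simp only [← ENNReal.rpow_neg]
  rw [Finset.prod_mul_distrib, ENNReal.prod_rpow_eq_rpow_sum _ (volume_cube_ne_zero a hℓ)
    (volume_cube_ne_top a ℓ)]
  congr 2
  simp only [Finset.sum_const, Finset.card_univ, Fintype.card_fin, nsmul_eq_mul]
  field_simp

theorem prodWeight_ne_top (ω : Fin m → (Fin n → ℝ) → ℝ≥0) (x : Fin n → ℝ) :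
    prodWeight ω x ≠ ∞ :=
  ENNReal.prod_ne_top fun _ _ => ENNReal.coe_ne_top

theorem exists_eLpNorm_fracMaximal_le (hm : 0 < m) (hn : 0 < n)
    (D : ExponentData P q (m - α / n) π r) :
    ∃ C : ℝ≥0, ∀ ω : Fin m → (Fin n → ℝ) → ℝ≥0, (∀ i, Measurable (ω i)) →
      weightConst P q ω < ∞ → ∀ f : Fin m → (Fin n → ℝ) → ℂ, (∀ i, Measurable (f i)) →
      eLpNorm (fracMaximal α f) (ENNReal.ofReal q)
          (volume.withDensity fun x => prodWeight ω x ^ q) ≤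
        C * weightConst P q ω ^ (π / q) *
          ∏ i, eLpNorm (f i) (ENNReal.ofReal (P i))
            (volume.withDensity fun x => (ω i x : ℝ≥0∞) ^ P i) := by
  have hq := D.q_pos
  have hs := D.s_pos
  have hP : ∀ i, 0 < P i := fun i => by linarith [D.one_lt_P i]
  obtain ⟨C, hC⟩ := exists_lintegral_rpow_le n D
  refine ⟨C ^ (1 / q), fun ω hω hK f hf => ?_⟩
  set K := weightConst P q ω with hKdef
  -- In this case the measure on the left is zero; otherwise all weights are positive almost
  -- everywhere and can be inverted.
  by_cases hν : prodWeight ω =ᵐ[volume] 0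
  · have h0 : (volume.withDensity fun x => prodWeight ω x ^ q) = 0 := by
      rw [withDensity_eq_zero_iff
        ((measurable_prodWeight hω).pow_const q).aemeasurable]
      filter_upwards [hν] with x hx
      simp [hx, hq]
    simp [h0]
  have hω0 : ∀ᵐ x, ∀ i, ω i x ≠ 0 :=
    ae_all_iff.2 (weight_ae_ne_zero D.one_lt_P hq hω hK.ne hν)
  have hc : ∀ i, 0 < (P i).conjExponent := fun i =>
    (Real.HolderConjugate.conjExponent (D.one_lt_P i)).symm.pos
  have hτ : ∀ i, 0 < 1 - 1 / P i := fun i => by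
    rw [← Real.inv_conjExponent_eq (D.one_lt_P i)]
    exact inv_pos.2 (hc i)
  set σ : Fin m → (Fin n → ℝ) → ℝ≥0∞ :=
    fun i x => (ω i x : ℝ≥0∞) ^ (-(P i).conjExponent) with hσdef
  set v : (Fin n → ℝ) → ℝ≥0∞ := fun x => prodWeight ω x ^ q with hvdef
  set g : Fin m → (Fin n → ℝ) → ℝ≥0∞ :=
    fun i x => ‖f i x‖ₑ * (ω i x : ℝ≥0∞) ^ (P i).conjExponent with hgdef
  have hσ : ∀ i, Measurable (σ i) := fun i => (hω i).coe_nnreal_ennreal.pow_const _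
  have hv : Measurable v := (measurable_prodWeight hω).pow_const q
  have hg : ∀ i, Measurable (g i) := fun i =>
    (hf i).enorm.mul ((hω i).coe_nnreal_ennreal.pow_const _)
  have hv0 : ∀ᵐ x, v x ≠ 0 := by
    filter_upwards [hω0] with x hx
    simp only [hvdef, Ne, ENNReal.rpow_eq_zero_iff_of_pos hq]
    exact Finset.prod_ne_zero_iff.2 fun i _ => by exact_mod_cast hx i
  have hvtop : ∀ᵐ x, v x ≠ ∞ :=
    Filter.Eventually.of_forall fun x => ENNReal.rpow_ne_top_of_nonneg hq.le (prodWeight_ne_top ω x)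
  have hσ0 : ∀ i, ∀ᵐ x, σ i x ≠ 0 := fun i => by
    refine Filter.Eventually.of_forall fun x => ?_
    simp only [hσdef, Ne, ENNReal.rpow_eq_zero_iff, not_or, not_and]
    exact ⟨fun _ => by linarith [hc i], fun h => absurd h ENNReal.coe_ne_top⟩
  have hone : ∀ᵐ x, v x ^ (1 / q) * ∏ i, σ i x ^ (1 - 1 / P i) = 1 := by
    filter_upwards [hω0] with x hx
    simp only [hvdef, hσdef]
    rw [← ENNReal.rpow_mul, mul_one_div_cancel hq.ne', ENNReal.rpow_one, prodWeight,
      ← Finset.prod_mul_distrib]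
    refine Finset.prod_eq_one fun i _ => ?_
    rw [← ENNReal.rpow_mul, ← Real.inv_conjExponent_eq (D.one_lt_P i), neg_mul,
      mul_inv_cancel₀ (hc i).ne', ENNReal.rpow_neg_one]
    exact ENNReal.mul_inv_cancel (by exact_mod_cast hx i) ENNReal.coe_ne_top
  have hS0 : ∀ i (a : Fin n → ℝ) (ℓ : ℝ), 0 < ℓ → volume.withDensity (σ i) (cube a ℓ) ≠ 0 :=
    fun i a ℓ hℓ => withDensity_apply_ne_zero (hσ i) (hσ0 i) (measurableSet_cube a ℓ)
      (volume_cube_ne_zero a hℓ)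
  have hV0 : ∀ (a : Fin n → ℝ) (ℓ : ℝ), 0 < ℓ → volume.withDensity v (cube a ℓ) ≠ 0 :=
    fun a ℓ hℓ => withDensity_apply_ne_zero hv hv0 (measurableSet_cube a ℓ)
      (volume_cube_ne_zero a hℓ)
  have hprod : ∀ (a : Fin n → ℝ) (ℓ : ℝ), 0 < ℓ → volume.withDensity v (cube a ℓ) *
      ∏ i, volume.withDensity (σ i) (cube a ℓ) ^ (q * (1 - 1 / P i)) ≤
        K * volume (cube a ℓ) ^ (q * (m - α / n)) := by
    intro a ℓ hℓ
    simp only [withDensity_apply _ (measurableSet_cube a ℓ)]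
    exact lintegral_mul_prod_le_weightConst D.one_lt_P hq D.sum_conj ω a hℓ
  have hprodtop : ∀ (a : Fin n → ℝ) (ℓ : ℝ), 0 < ℓ → volume.withDensity v (cube a ℓ) *
      ∏ i, volume.withDensity (σ i) (cube a ℓ) ^ (q * (1 - 1 / P i)) ≠ ∞ := fun a ℓ hℓ =>
    ((hprod a ℓ hℓ).trans_lt (ENNReal.mul_lt_top hK (ENNReal.rpow_lt_top_of_nonneg
      (by positivity) (volume_cube_ne_top a ℓ)))).ne
  have hSp0 : ∀ i (a : Fin n → ℝ) (ℓ : ℝ), 0 < ℓ →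
      volume.withDensity (σ i) (cube a ℓ) ^ (q * (1 - 1 / P i)) ≠ 0 := fun i a ℓ hℓ => by
    rw [Ne, ENNReal.rpow_eq_zero_iff_of_pos (mul_pos hq (hτ i))]
    exact hS0 i a ℓ hℓ
  -- Local finiteness is not assumed: the product is finite and its other factors are nonzero, so no
  -- factor is infinite. The same argument serves the `σ i`.
  have hVtop : ∀ (a : Fin n → ℝ) (ℓ : ℝ), 0 < ℓ → volume.withDensity v (cube a ℓ) ≠ ∞ := by
    intro a ℓ hℓ h
    refine hprodtop a ℓ hℓ ?_
    rw [h, ENNReal.top_mul (Finset.prod_ne_zero_iff.2 fun i _ => hSp0 i a ℓ hℓ)]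
  have hStop : ∀ i (a : Fin n → ℝ) (ℓ : ℝ), 0 < ℓ →
      volume.withDensity (σ i) (cube a ℓ) ≠ ∞ := by
    intro i a ℓ hℓ h
    refine hprodtop a ℓ hℓ ?_
    rw [← Finset.mul_prod_erase _ _ (Finset.mem_univ i), h,
      ENNReal.top_rpow_of_pos (mul_pos hq (hτ i)),
      ENNReal.top_mul (Finset.prod_ne_zero_iff.2 fun i _ => hSp0 i a ℓ hℓ),
      ENNReal.mul_top (hV0 a ℓ hℓ)]
  have hgσ : ∀ i, ∀ᵐ x, σ i x * g i x = ‖f i x‖ₑ := fun i => by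
    filter_upwards [hω0] with x hx
    have h0 : (ω i x : ℝ≥0∞) ≠ 0 := by exact_mod_cast hx i
    simp only [hσdef, hgdef]
    rw [mul_left_comm, ← ENNReal.rpow_add _ _ h0 ENNReal.coe_ne_top, neg_add_cancel,
      ENNReal.rpow_zero, mul_one]
  have hW : ∀ i, ∫⁻ y, g i y ^ P i ∂(volume.withDensity (σ i)) =
      ∫⁻ y, ‖f i y‖ₑ ^ P i ∂(volume.withDensity fun x => (ω i x : ℝ≥0∞) ^ P i) := by
    intro i
    rw [lintegral_withDensity_eq_lintegral_mul _ (hσ i) ((hg i).pow_const _),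
      lintegral_withDensity_eq_lintegral_mul _ ((hω i).coe_nnreal_ennreal.pow_const _)
        ((hf i).enorm.pow_const _)]
    refine lintegral_congr_ae ?_
    filter_upwards [hω0] with x hx
    have h0 : (ω i x : ℝ≥0∞) ≠ 0 := by exact_mod_cast hx i
    simp only [hσdef, hgdef, Pi.mul_apply]
    rw [ENNReal.mul_rpow_of_nonneg _ _ (hP i).le, mul_left_comm, ← ENNReal.rpow_mul,
      ← ENNReal.rpow_add _ _ h0 ENNReal.coe_ne_top, mul_comm]
    congr 2
    have h1 : P i - 1 ≠ 0 := by linarith [D.one_lt_P i]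
    rw [Real.conjExponent]
    field_simp
    ring
  have hT := hC σ g v (fracMaximal α f) K hσ hg hv hv0 hvtop (fun x => by
    refine iSup_le fun a => iSup_le fun ℓ => iSup_le fun hℓ => iSup_le fun hx => ?_
    have h5 : 0 < 5 * ℓ := by linarith
    rw [prod_average_eq hm hn α a hℓ]
    refine le_trans (le_of_eq ?_) (prod_average_le D hσ hg hv hv0 hvtop hone hℓ hx
      (fun i => hS0 i _ _ h5) (fun i => hStop i _ _ h5) (hV0 _ _ h5) (hVtop _ _ h5)
      (hprod _ _ h5))
    congr 1
    refine Finset.prod_congr rfl fun i _ => ?_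
    rw [setLIntegral_withDensity_eq_setLIntegral_mul _ (hσ i) (hg i) (measurableSet_cube a ℓ)]
    exact lintegral_congr_ae (ae_restrict_of_ae (by
      filter_upwards [hgσ i] with x hx
      exact hx.symm)))
  rw [eLpNorm_ofReal_eq_lintegral _ _ hq]
  simp only [eLpNorm_ofReal_eq_lintegral _ _ (hP _), ← hW, enorm_eq_self]
  refine (ENNReal.rpow_le_rpow hT (by positivity)).trans_eq ?_
  rw [ENNReal.mul_rpow_of_nonneg _ _ (by positivity),
    ENNReal.mul_rpow_of_nonneg _ _ (by positivity), ← ENNReal.rpow_mul, mul_one_div,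
    ← ENNReal.prod_rpow_of_nonneg (by positivity), ENNReal.coe_rpow_of_nonneg _ (by positivity)]
  congr 1
  refine Finset.prod_congr rfl fun i _ => ?_
  rw [← ENNReal.rpow_mul]
  congr 1
  field_simp

theorem div_mem_admissiblePowers (hm : 0 < m) (hn : 0 < n)
    (D : ExponentData P q (m - α / n) π r) : π / q ∈ admissiblePowers n α P q := by
  obtain ⟨C, hC⟩ := exists_eLpNorm_fracMaximal_le hm hn D
  refine ⟨C, fun ω hω f hf => ?_⟩
  choose ω' hω'm hω' using hω.1
  choose f' hf'm hf' using hf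
  have h1 : (volume.withDensity fun x => prodWeight ω x ^ q) =
      volume.withDensity fun x => prodWeight ω' x ^ q :=
    withDensity_congr_ae (by filter_upwards [prodWeight_congr_ae hω'] with x hx; rw [hx])
  have h2 : ∀ i, eLpNorm (f i) (ENNReal.ofReal (P i))
        (volume.withDensity fun x => (ω i x : ℝ≥0∞) ^ P i) =
      eLpNorm (f' i) (ENNReal.ofReal (P i))
        (volume.withDensity fun x => (ω' i x : ℝ≥0∞) ^ P i) := fun i => by
    have h3 : (volume.withDensity fun x => (ω i x : ℝ≥0∞) ^ P i) =
        volume.withDensity fun x => (ω' i x : ℝ≥0∞) ^ P i :=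
      withDensity_congr_ae (by filter_upwards [hω' i] with x hx; rw [hx])
    have h4 := (withDensity_absolutelyContinuous volume
      fun x => (ω' i x : ℝ≥0∞) ^ P i).ae_eq (hf' i)
    rw [h3]
    exact eLpNorm_congr_ae h4
  have hK := hω.2
  rw [weightConst_congr_ae P q hω'] at hK ⊢
  rw [h1, fracMaximal_congr_ae α hf', Finset.prod_congr rfl fun i _ => h2 i]
  exact hC ω' hω'm hK f' hf'm

end MultilinearFractional

/-! ### Lower bound: radial integrals and power weights -/

theorem ENNReal.prod_rpow_eq_rpow_sum_of_nonneg {ι : Type*} (s : Finset ι) (x : ℝ≥0∞) {f : ι → ℝ}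
    (hf : ∀ i ∈ s, 0 ≤ f i) : ∏ i ∈ s, x ^ f i = x ^ ∑ i ∈ s, f i := by
  induction s using Finset.cons_induction with
  | empty => simp
  | cons i s hi ih =>
    rw [Finset.prod_cons, Finset.sum_cons, ih fun j hj => hf j (Finset.mem_cons_of_mem hj),
      ENNReal.rpow_add_of_nonneg _ _ (hf i (Finset.mem_cons_self _ _))
        (Finset.sum_nonneg fun j hj => hf j (Finset.mem_cons_of_mem hj))]

theorem enorm_rpow_eq_ofReal {E : Type*} [NormedAddCommGroup E] {x : E} (hx : x ≠ 0) (a : ℝ) :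
    ‖x‖ₑ ^ a = ENNReal.ofReal (‖x‖ ^ a) := by
  rw [← ofReal_norm, ENNReal.ofReal_rpow_of_pos (norm_pos_iff.2 hx)]

section RadialIntegral

variable {n : ℕ}

theorem ae_ne_zero_of_pos (hn : 0 < n) : ∀ᵐ x : Fin n → ℝ, x ≠ 0 := by
  have : Nonempty (Fin n) := ⟨⟨0, hn⟩⟩
  have : Nontrivial (Fin n → ℝ) := inferInstance
  exact ae_iff.2 (by simp)

/-- The integral of `‖x‖ ^ (ε - n)` over the closed ball of radius `R`, for the sup norm. -/
theorem setLIntegral_enorm_rpow_closedBall (hn : 0 < n) {ε R : ℝ} (hε : 0 < ε) (hR : 0 < R) :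
    ∫⁻ x in Metric.closedBall (0 : Fin n → ℝ) R, ‖x‖ₑ ^ (ε - n) =
      ENNReal.ofReal (n * 2 ^ n * R ^ ε / ε) := by
  have : Nonempty (Fin n) := ⟨⟨0, hn⟩⟩
  set f : ℝ → ℝ := (Set.Iic R).indicator fun y => y ^ (ε - n) with hf
  have hfun : ∀ y ∈ Set.Ioi (0 : ℝ), y ^ (n - 1) • f y =
      (Set.Ioc 0 R).indicator (fun y => y ^ (ε - 1)) y := by
    intro y hy
    rw [Set.mem_Ioi] at hy
    by_cases h : y ≤ R
    · simp only [hf, Set.indicator, Set.mem_Iic, h, Set.mem_Ioc, hy, and_self, if_true, smul_eq_mul]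
      rw [← Real.rpow_natCast, ← Real.rpow_add hy, Nat.cast_pred hn]
      congr 1
      ring
    · simp [hf, h]
  have hint : IntegrableOn (fun y : ℝ => y ^ (ε - 1)) (Set.Ioc 0 R) :=
    (intervalIntegral.intervalIntegrable_rpow' (by linarith)).1
  have hint' : IntegrableOn (fun y : ℝ => y ^ (n - 1) • f y) (Set.Ioi 0) := by
    rw [integrableOn_congr_fun hfun measurableSet_Ioi]
    exact (hint.integrable_indicator measurableSet_Ioc).integrableOn
  have hval : ∫ y in Set.Ioi (0 : ℝ), y ^ (n - 1) • f y = R ^ ε / ε := by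
    rw [setIntegral_congr_fun measurableSet_Ioi hfun, setIntegral_indicator measurableSet_Ioc,
      Set.inter_eq_right.2 Set.Ioc_subset_Ioi_self, ← intervalIntegral.integral_of_le hR.le,
      integral_rpow (.inl (by linarith)), sub_add_cancel, Real.zero_rpow hε.ne', sub_zero]
  have hinteg : Integrable (fun x : Fin n → ℝ => f ‖x‖) := by
    rw [integrable_fun_norm_addHaar]
    simpa using hint'
  have hball : volume.real (Metric.ball (0 : Fin n → ℝ) 1) = 2 ^ n := by
    rw [measureReal_def, Real.volume_pi_ball _ one_pos, ENNReal.toReal_ofReal (by positivity)]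
    simp
  have hI : ∫ x : Fin n → ℝ, f ‖x‖ = n * 2 ^ n * R ^ ε / ε := by
    rw [integral_fun_norm_addHaar]
    simp only [Module.finrank_fin_fun, hball]
    rw [hval]
    simp only [smul_eq_mul, nsmul_eq_mul]
    ring
  rw [← hI, ofReal_integral_eq_lintegral_ofReal hinteg
    (Filter.Eventually.of_forall fun x =>
      Set.indicator_apply_nonneg fun _ => Real.rpow_nonneg (norm_nonneg _) _),
    ← lintegral_indicator Metric.isClosed_closedBall.measurableSet]
  refine lintegral_congr_ae ?_
  filter_upwards [ae_ne_zero_of_pos hn] with x hx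
  by_cases h : ‖x‖ ≤ R
  · simp [hf, Set.indicator, h, enorm_rpow_eq_ofReal hx]
  · simp [hf, Set.indicator, h]

end RadialIntegral

namespace MultilinearFractional

variable {n m : ℕ} {P : Fin m → ℝ}

/-- The power weights `‖x‖ ^ ((n - δ) / pᵢ')`. -/
noncomputable def powerWeight (n : ℕ) (P : Fin m → ℝ) (δ : ℝ) (i : Fin m) (x : Fin n → ℝ) : ℝ≥0 :=
  ‖x‖₊ ^ ((n - δ) * (1 - 1 / P i))

theorem measurable_powerWeight (P : Fin m → ℝ) (δ : ℝ) (i : Fin m) :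
    Measurable (powerWeight n P δ i) :=
  measurable_nnnorm.pow_const _

theorem one_sub_inv_pos {P : ℝ} (hP : 1 < P) : 0 < 1 - 1 / P := by
  rw [sub_pos, div_lt_one (by linarith)]
  exact hP

theorem coe_powerWeight (hP : ∀ i, 1 < P i) {δ : ℝ} (hδ : δ ≤ n) (i : Fin m) (x : Fin n → ℝ) :
    (powerWeight n P δ i x : ℝ≥0∞) = ‖x‖ₑ ^ ((n - δ) * (1 - 1 / P i)) := by
  rw [powerWeight, ENNReal.coe_rpow_of_nonneg _
    (mul_nonneg (by linarith) (one_sub_inv_pos (hP i)).le)]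
  rfl

theorem coe_powerWeight_rpow_neg (hP : ∀ i, 1 < P i) {δ : ℝ} (hδ : δ ≤ n) (i : Fin m)
    (x : Fin n → ℝ) :
    (powerWeight n P δ i x : ℝ≥0∞) ^ (-(P i).conjExponent) = ‖x‖ₑ ^ (δ - n) := by
  have hc : (P i).conjExponent ≠ 0 := (Real.HolderConjugate.conjExponent (hP i)).symm.ne_zero
  rw [coe_powerWeight hP hδ, ← ENNReal.rpow_mul, ← Real.inv_conjExponent_eq (hP i)]
  congr 1
  field_simp
  ring

theorem prodWeight_powerWeight_rpow (hP : ∀ i, 1 < P i) {δ : ℝ} (hδ : δ ≤ n) (q : ℝ)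
    (x : Fin n → ℝ) :
    prodWeight (powerWeight n P δ) x ^ q = ‖x‖ₑ ^ ((n - δ) * (q * ∑ i, (1 - 1 / P i))) := by
  simp only [prodWeight, coe_powerWeight hP hδ]
  rw [ENNReal.prod_rpow_eq_rpow_sum_of_nonneg _ _
    fun i _ => mul_nonneg (by linarith) (one_sub_inv_pos (hP i)).le, ← Finset.mul_sum,
    ← ENNReal.rpow_mul]
  congr 1
  ring

theorem laverage_le_of_forall_le {X : Type*} [MeasurableSpace X] (μ : Measure X) {s : Set X}
    (hs : MeasurableSet s) (h0 : μ s ≠ 0) (htop : μ s ≠ ∞) {f : X → ℝ≥0∞} {c : ℝ≥0∞}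
    (h : ∀ x ∈ s, f x ≤ c) : ⨍⁻ x in s, f x ∂μ ≤ c := by
  rw [setLAverage_eq]
  refine (ENNReal.div_le_div_right (setLIntegral_mono' hs h) _).trans ?_
  rw [setLIntegral_const, mul_div_assoc, ENNReal.div_self h0 htop, mul_one]

theorem le_laverage_of_forall_le {X : Type*} [MeasurableSpace X] (μ : Measure X) {s : Set X}
    (hs : MeasurableSet s) (h0 : μ s ≠ 0) (htop : μ s ≠ ∞) {f : X → ℝ≥0∞} {c : ℝ≥0∞}
    (h : ∀ x ∈ s, c ≤ f x) : c ≤ ⨍⁻ x in s, f x ∂μ := by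
  rw [setLAverage_eq]
  refine le_trans ?_ (ENNReal.div_le_div_right (setLIntegral_mono' hs h) _)
  rw [setLIntegral_const, mul_div_assoc, ENNReal.div_self h0 htop, mul_one]

/-- The weights are chosen so that every dual weight is the same function `‖x‖ ^ (δ - n)`; the `m`
dual averages therefore merge into one. -/
theorem weightConst_powerWeight_term (hP : ∀ i, 1 < P i) {q δ : ℝ} (hq : 0 < q) (hδ : δ ≤ n)
    (s : Set (Fin n → ℝ)) :
    (⨍⁻ x in s, prodWeight (powerWeight n P δ) x ^ q ∂volume) *
      ∏ i, (⨍⁻ x in s, (powerWeight n P δ i x : ℝ≥0∞) ^ (-(P i).conjExponent) ∂volume) ^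
        (q / (P i).conjExponent) =
    (⨍⁻ x in s, ‖x‖ₑ ^ ((n - δ) * (q * ∑ i, (1 - 1 / P i))) ∂volume) *
      (⨍⁻ x in s, ‖x‖ₑ ^ (δ - n) ∂volume) ^ (q * ∑ i, (1 - 1 / P i)) := by
  simp only [prodWeight_powerWeight_rpow hP hδ, coe_powerWeight_rpow_neg hP hδ, div_eq_mul_inv q,
    Real.inv_conjExponent_eq (hP _)]
  rw [ENNReal.prod_rpow_eq_rpow_sum_of_nonneg _ _
    fun i _ => mul_nonneg hq.le (one_sub_inv_pos (hP i)).le, Finset.mul_sum]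

theorem norm_le_add_of_mem_cube {a x : Fin n → ℝ} {ℓ : ℝ} (hℓ : 0 ≤ ℓ) (hx : x ∈ cube a ℓ)
    {y : Fin n → ℝ} (hy : y ∈ cube a ℓ) : ‖x‖ ≤ ‖y‖ + ℓ := by
  have h : ‖x - y‖ ≤ ℓ := by
    rw [← dist_eq_norm]
    exact Metric.mem_closedBall.1 (cube_subset_closedBall hy hℓ le_rfl hx)
  have := norm_sub_norm_le x y
  linarith

/-- A cube with a point of norm at most `ℓ` lies in the ball of radius `2 * ℓ`, and the factor `1 /
δ` comes from integrating `‖x‖ ^ (δ - n)` there. On any other cube `‖x‖` stays between half and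
twice the norm of the corner, so the product of the two powers is bounded. -/
theorem laverage_enorm_rpow_mul_le (hn : 0 < n) {δ T : ℝ} (hδ0 : 0 < δ) (hδ : δ ≤ 1) (hT : 0 ≤ T)
    (a : Fin n → ℝ) {ℓ : ℝ} (hℓ : 0 < ℓ) :
    (⨍⁻ x in cube a ℓ, ‖x‖ₑ ^ ((n - δ) * T) ∂volume) *
      (⨍⁻ x in cube a ℓ, ‖x‖ₑ ^ (δ - n) ∂volume) ^ T ≤
    ENNReal.ofReal (n * 4 ^ n / δ) ^ T := by
  have hn1 : (1 : ℝ) ≤ n := by exact_mod_cast hn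
  have hnδ : 0 ≤ n - δ := by linarith
  have hm := measurableSet_cube a ℓ
  have h0 := volume_cube_ne_zero a hℓ
  have htop := volume_cube_ne_top a ℓ
  suffices H : ∃ U Y : ℝ≥0∞, (∀ x ∈ cube a ℓ, ‖x‖ₑ ^ (n - δ) ≤ U) ∧
      ⨍⁻ x in cube a ℓ, ‖x‖ₑ ^ (δ - n) ∂volume ≤ Y ∧ U * Y ≤ ENNReal.ofReal (n * 4 ^ n / δ) by
    obtain ⟨U, Y, hU, hY, hUY⟩ := H
    calc _ ≤ U ^ T * Y ^ T := by
          gcongr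
          refine laverage_le_of_forall_le volume hm h0 htop fun x hx => ?_
          rw [ENNReal.rpow_mul]
          exact ENNReal.rpow_le_rpow (hU x hx) hT
      _ = (U * Y) ^ T := (ENNReal.mul_rpow_of_nonneg _ _ hT).symm
      _ ≤ _ := ENNReal.rpow_le_rpow hUY hT
  by_cases hcase : ∃ x ∈ cube a ℓ, ‖x‖ ≤ ℓ
  · obtain ⟨x₀, hx₀, hx₀ℓ⟩ := hcase
    have hsub : cube a ℓ ⊆ Metric.closedBall 0 (2 * ℓ) := by
      intro x hx
      rw [mem_closedBall_zero_iff]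
      have := norm_le_add_of_mem_cube hℓ.le hx hx₀
      linarith
    refine ⟨ENNReal.ofReal ((2 * ℓ) ^ (n - δ)), ENNReal.ofReal (n * 2 ^ n * (2 * ℓ) ^ δ / δ / ℓ ^ n),
      fun x hx => ?_, ?_, ?_⟩
    · rw [← ENNReal.ofReal_rpow_of_pos (by linarith), ← ofReal_norm]
      exact ENNReal.rpow_le_rpow
        (ENNReal.ofReal_le_ofReal (mem_closedBall_zero_iff.1 (hsub hx))) hnδ
    · rw [setLAverage_eq, volume_cube, ← ENNReal.ofReal_pow hℓ.le,
        ENNReal.ofReal_div_of_pos (y := ℓ ^ n) (by positivity),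
        ← setLIntegral_enorm_rpow_closedBall hn hδ0 (by linarith : 0 < 2 * ℓ)]
      exact ENNReal.div_le_div_right (lintegral_mono_set hsub) _
    · rw [← ENNReal.ofReal_mul (by positivity)]
      refine le_of_eq ?_
      congr 1
      have e : (2 * ℓ) ^ (n - δ) * (2 * ℓ) ^ δ = 2 ^ n * ℓ ^ n := by
        rw [← Real.rpow_add (by linarith), sub_add_cancel, Real.rpow_natCast, mul_pow]
      calc (2 * ℓ) ^ (n - δ) * (n * 2 ^ n * (2 * ℓ) ^ δ / δ / ℓ ^ n)
          = ((2 * ℓ) ^ (n - δ) * (2 * ℓ) ^ δ) * (n * 2 ^ n / δ / ℓ ^ n) := by ring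
        _ = n * 4 ^ n / δ := by
          rw [e, show (4 : ℝ) = 2 * 2 by norm_num, mul_pow]
          field_simp
  · push Not at hcase
    have ha : a ∈ cube a ℓ := fun j => ⟨le_rfl, by linarith⟩
    set ρ := ‖a‖ with hρ
    have hρ0 : 0 < ρ := hℓ.trans (hcase a ha)
    refine ⟨ENNReal.ofReal ((2 * ρ) ^ (n - δ)), ENNReal.ofReal ((ρ / 2) ^ (δ - n)),
      fun x hx => ?_, ?_, ?_⟩
    · rw [← ENNReal.ofReal_rpow_of_pos (by linarith), ← ofReal_norm]
      refine ENNReal.rpow_le_rpow (ENNReal.ofReal_le_ofReal ?_) hnδ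
      have := norm_le_add_of_mem_cube hℓ.le hx ha
      have := hcase a ha
      linarith
    · refine laverage_le_of_forall_le volume hm h0 htop fun x hx => ?_
      have h1 := norm_le_add_of_mem_cube hℓ.le ha hx
      have h3 := hcase x hx
      rw [enorm_rpow_eq_ofReal (norm_pos_iff.1 (hℓ.trans h3))]
      refine ENNReal.ofReal_le_ofReal ?_
      exact Real.rpow_le_rpow_of_nonpos (by linarith) (by linarith) (by linarith)
    · rw [← ENNReal.ofReal_mul (by positivity)]
      refine ENNReal.ofReal_le_ofReal ?_
      have e : (2 * ρ) ^ (n - δ) * (ρ / 2) ^ (δ - n) = 4 ^ (n - δ) := by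
        rw [show 2 * ρ = 4 * (ρ / 2) by ring, Real.mul_rpow (by norm_num) (by linarith), mul_assoc,
          ← Real.rpow_add (by linarith)]
        simp
      rw [e]
      calc (4 : ℝ) ^ (n - δ) ≤ 4 ^ (n : ℝ) :=
            Real.rpow_le_rpow_of_exponent_le (by norm_num) (by linarith)
        _ = 4 ^ n := Real.rpow_natCast _ _
        _ ≤ n * 4 ^ n / δ := by
            rw [le_div_iff₀ hδ0, mul_comm]
            gcongr
            linarith

theorem weightConst_powerWeight_le (hn : 0 < n) (hP : ∀ i, 1 < P i) {q δ : ℝ} (hq : 0 < q)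
    (hδ0 : 0 < δ) (hδ : δ ≤ 1) :
    weightConst P q (powerWeight n P δ) ≤
      ENNReal.ofReal (n * 4 ^ n / δ) ^ (q * ∑ i, (1 - 1 / P i)) := by
  have hn1 : (1 : ℝ) ≤ n := by exact_mod_cast hn
  refine iSup_le fun a => iSup_le fun ℓ => iSup_le fun hℓ => ?_
  rw [weightConst_powerWeight_term hP hq (by linarith)]
  exact laverage_enorm_rpow_mul_le hn hδ0 hδ
    (mul_nonneg hq.le (Finset.sum_nonneg fun i _ => (one_sub_inv_pos (hP i)).le)) a hℓ

/-- The cube $[1,2]^n$ gives a bound free of `δ`. It serves negative `γ`, where an upper bound for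
the power of the constant requires a lower bound for the constant. -/
theorem le_weightConst_powerWeight (hn : 0 < n) (hP : ∀ i, 1 < P i) {q δ : ℝ} (hq : 0 < q)
    (hδ0 : 0 < δ) (hδ : δ ≤ 1) :
    ENNReal.ofReal (2 ^ (-(n : ℝ))) ^ (q * ∑ i, (1 - 1 / P i)) ≤
      weightConst P q (powerWeight n P δ) := by
  have hn1 : (1 : ℝ) ≤ n := by exact_mod_cast hn
  have : Nonempty (Fin n) := ⟨⟨0, hn⟩⟩
  set T := q * ∑ i, (1 - 1 / P i) with hT
  have hT0 : 0 ≤ T :=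
    mul_nonneg hq.le (Finset.sum_nonneg fun i _ => (one_sub_inv_pos (hP i)).le)
  refine le_trans ?_ (le_weightConst P q (powerWeight n P δ) (fun _ => 1) one_pos)
  rw [weightConst_powerWeight_term hP hq (by linarith), ← hT]
  set Q := cube (fun _ : Fin n => (1 : ℝ)) 1 with hQ
  have hm : MeasurableSet Q := measurableSet_cube _ _
  have h0 : volume Q ≠ 0 := volume_cube_ne_zero _ one_pos
  have htop : volume Q ≠ ∞ := volume_cube_ne_top _ _
  have h1 : ∀ x ∈ Q, 1 ≤ ‖x‖ := fun x hx => by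
    have h2 := (hx ⟨0, hn⟩).1
    have h3 := norm_le_pi_norm x ⟨0, hn⟩
    rw [Real.norm_eq_abs] at h3
    exact (h2.trans (le_abs_self _)).trans h3
  have h2 : ∀ x ∈ Q, ‖x‖ ≤ 2 := fun x hx => by
    rw [pi_norm_le_iff_of_nonneg (by norm_num)]
    intro j
    have := hx j
    rw [Real.norm_eq_abs, abs_le]
    constructor <;> linarith
  have h3 : 1 ≤ ⨍⁻ x in Q, ‖x‖ₑ ^ ((n - δ) * T) ∂volume := by
    refine le_laverage_of_forall_le volume hm h0 htop fun x hx => ?_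
    rw [← ENNReal.one_rpow ((n - δ) * T)]
    refine ENNReal.rpow_le_rpow ?_ (mul_nonneg (by linarith) hT0)
    rw [← ofReal_norm, ENNReal.one_le_ofReal]
    exact h1 x hx
  have h4 : ENNReal.ofReal (2 ^ (-(n : ℝ))) ≤ ⨍⁻ x in Q, ‖x‖ₑ ^ (δ - n) ∂volume := by
    refine le_laverage_of_forall_le volume hm h0 htop fun x hx => ?_
    have hx1 := h1 x hx
    rw [enorm_rpow_eq_ofReal (norm_pos_iff.1 (one_pos.trans_le hx1))]
    refine ENNReal.ofReal_le_ofReal ?_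
    calc (2 : ℝ) ^ (-(n : ℝ)) ≤ 2 ^ (δ - n) :=
          Real.rpow_le_rpow_of_exponent_le (by norm_num) (by linarith)
      _ ≤ ‖x‖ ^ (δ - n) := Real.rpow_le_rpow_of_nonpos (by linarith) (h2 x hx) (by linarith)
  calc _ = 1 * ENNReal.ofReal (2 ^ (-(n : ℝ))) ^ T := (one_mul _).symm
    _ ≤ _ := by gcongr

/-- Uniform control of the powers of the constants of the power weights as `δ → 0`. -/
theorem exists_weightConst_powerWeight_rpow_le (hn : 0 < n) (hP : ∀ i, 1 < P i) {q : ℝ}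
    (hq : 0 < q) (γ : ℝ) :
    ∃ c : ℝ, 0 < c ∧ ∀ δ : ℝ, 0 < δ → δ ≤ 1 → weightConst P q (powerWeight n P δ) ^ γ ≤
      ENNReal.ofReal (c * (1 / δ) ^ (q * (∑ i, (1 - 1 / P i)) * max γ 0)) := by
  have hn0 : (0 : ℝ) < n := by exact_mod_cast hn
  set T := q * ∑ i, (1 - 1 / P i) with hT
  rcases le_total 0 γ with hγ | hγ
  · refine ⟨(n * 4 ^ n) ^ (T * γ), by positivity, fun δ hδ0 hδ => ?_⟩
    refine (ENNReal.rpow_le_rpow (weightConst_powerWeight_le hn hP hq hδ0 hδ) hγ).trans_eq ?_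
    rw [← ENNReal.rpow_mul, ENNReal.ofReal_rpow_of_pos (by positivity), max_eq_left hγ, ← hT,
      ← Real.mul_rpow (by positivity) (by positivity), mul_one_div]
  · refine ⟨((2 : ℝ) ^ (-(n : ℝ))) ^ (T * γ), by positivity, fun δ hδ0 hδ => ?_⟩
    rw [max_eq_right hγ, mul_zero, Real.rpow_zero, mul_one,
      ← ENNReal.ofReal_rpow_of_pos (by positivity), ENNReal.rpow_mul]
    rw [← neg_neg γ, ENNReal.rpow_neg, ENNReal.rpow_neg _ (-γ), ENNReal.inv_le_inv]
    exact ENNReal.rpow_le_rpow (le_weightConst_powerWeight hn hP hq hδ0 hδ) (neg_nonneg.2 hγ)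

end MultilinearFractional

/-! ### Lower bound: test functions and comparison of exponents -/

namespace MultilinearFractional

variable {n m : ℕ} {P : Fin m → ℝ}

/-- The test function `‖x‖ ^ (δ - n)` on the unit ball. -/
noncomputable def powerFun (n : ℕ) (δ : ℝ) : (Fin n → ℝ) → ℂ :=
  (Metric.closedBall 0 1).indicator fun x => ((‖x‖ ^ (δ - n) : ℝ) : ℂ)

theorem measurable_powerFun (δ : ℝ) : Measurable (powerFun n δ) :=
  (Complex.measurable_ofReal.comp (measurable_norm.pow_const _)).indicator
    Metric.isClosed_closedBall.measurableSet

theorem enorm_powerFun {δ : ℝ} {x : Fin n → ℝ} (hx : x ≠ 0) (hx1 : ‖x‖ ≤ 1) :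
    ‖powerFun n δ x‖ₑ = ‖x‖ₑ ^ (δ - n) := by
  rw [powerFun, Set.indicator_of_mem (mem_closedBall_zero_iff.2 hx1), enorm_rpow_eq_ofReal hx,
    ← ofReal_norm, Complex.norm_real, Real.norm_of_nonneg (by positivity)]

theorem powerFun_eq_zero {δ : ℝ} {x : Fin n → ℝ} (hx1 : ¬ ‖x‖ ≤ 1) : powerFun n δ x = 0 :=
  Set.indicator_of_notMem (by rwa [mem_closedBall_zero_iff]) _

theorem eLpNorm_powerFun (hn : 0 < n) (hP : ∀ i, 1 < P i) {δ : ℝ} (hδ0 : 0 < δ) (hδ : δ ≤ n)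
    (i : Fin m) :
    eLpNorm (powerFun n δ) (ENNReal.ofReal (P i))
        (volume.withDensity fun x => (powerWeight n P δ i x : ℝ≥0∞) ^ P i) =
      ENNReal.ofReal (n * 2 ^ n / δ) ^ (1 / P i) := by
  have hPi : 0 < P i := by linarith [hP i]
  rw [eLpNorm_ofReal_eq_lintegral _ _ hPi, lintegral_withDensity_eq_lintegral_mul _
    ((measurable_powerWeight P δ i).coe_nnreal_ennreal.pow_const _)
    ((measurable_powerFun δ).enorm.pow_const _)]
  congr 1
  have h := setLIntegral_enorm_rpow_closedBall hn hδ0 one_pos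
  rw [Real.one_rpow, mul_one] at h
  rw [← h, ← lintegral_indicator Metric.isClosed_closedBall.measurableSet]
  refine lintegral_congr_ae ?_
  filter_upwards [ae_ne_zero_of_pos hn] with x hx
  by_cases hx1 : ‖x‖ ≤ 1
  · rw [Set.indicator_of_mem (mem_closedBall_zero_iff.2 hx1), Pi.mul_apply,
      enorm_powerFun hx hx1, coe_powerWeight hP hδ, ← ENNReal.rpow_mul, ← ENNReal.rpow_mul,
      ← ENNReal.rpow_add _ _ (by simpa using hx) enorm_ne_top]
    congr 1
    field_simp
    ring
  · rw [Set.indicator_of_notMem (by rwa [mem_closedBall_zero_iff]), Pi.mul_apply,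
      powerFun_eq_zero hx1]
    simp [hPi]

theorem cube_neg_eq_closedBall {ρ : ℝ} (hρ : 0 ≤ ρ) :
    cube (fun _ : Fin n => -ρ) (2 * ρ) = Metric.closedBall 0 ρ := by
  ext x
  rw [mem_closedBall_zero_iff, pi_norm_le_iff_of_nonneg hρ]
  refine forall_congr' fun j => ?_
  rw [Real.norm_eq_abs, abs_le]
  constructor <;> rintro ⟨h1, h2⟩ <;> constructor <;> linarith

/-- Test with the cube centered at the origin having `x` on its boundary; each of the `m` integrals
contributes a factor `1 / δ`. -/
theorem le_fracMaximal_powerFun (hn : 0 < n) (hm : 0 < m) (α : ℝ) {δ : ℝ} (hδ0 : 0 < δ)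
    {x : Fin n → ℝ} (hx : x ≠ 0) (hx1 : ‖x‖ ≤ 1) :
    ENNReal.ofReal ((2 ^ n) ^ (-(m - α / n)) * (n * 2 ^ n / δ) ^ m) *
        ‖x‖ₑ ^ (m * δ - (n * m - α)) ≤
      fracMaximal α (fun _ : Fin m => powerFun n δ) x := by
  have hx0 : 0 < ‖x‖ := norm_pos_iff.2 hx
  have hn' : (0 : ℝ) < n := by exact_mod_cast hn
  have hcube := cube_neg_eq_closedBall (n := n) hx0.le
  refine le_trans (le_of_eq ?_) (le_iSup_of_le (fun _ => -‖x‖) (le_iSup_of_le (2 * ‖x‖)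
    (le_iSup_of_le (by linarith) (le_iSup_of_le (by rw [hcube]; simp) le_rfl))))
  rw [prod_average_eq hm hn α _ (by linarith), Finset.prod_const, Finset.card_univ,
    Fintype.card_fin, volume_cube, hcube]
  have hI : ∫⁻ y in Metric.closedBall 0 ‖x‖, ‖powerFun n δ y‖ₑ =
      ENNReal.ofReal (n * 2 ^ n * ‖x‖ ^ δ / δ) := by
    rw [← setLIntegral_enorm_rpow_closedBall hn hδ0 hx0]
    refine lintegral_congr_ae ?_
    filter_upwards [ae_restrict_mem Metric.isClosed_closedBall.measurableSet,
      ae_restrict_of_ae (ae_ne_zero_of_pos hn)] with y hy hy0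
    exact enorm_powerFun hy0 ((mem_closedBall_zero_iff.1 hy).trans hx1)
  rw [hI, enorm_rpow_eq_ofReal hx, ← ENNReal.ofReal_mul (by positivity),
    ← ENNReal.ofReal_pow (by positivity), ← ENNReal.ofReal_pow (by positivity),
    ENNReal.ofReal_rpow_of_pos (by positivity), ← ENNReal.ofReal_mul (by positivity)]
  congr 1
  rw [mul_pow 2 ‖x‖, Real.mul_rpow (by positivity) (by positivity),
    mul_div_right_comm _ (‖x‖ ^ δ), mul_pow _ (‖x‖ ^ δ), ← Real.rpow_natCast ‖x‖ n, ← Real.rpow_mul hx0.le,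
    ← Real.rpow_natCast (‖x‖ ^ δ) m, ← Real.rpow_mul hx0.le]
  have e : ‖x‖ ^ (m * δ - (n * m - α)) = ‖x‖ ^ (n * -(m - α / n)) * ‖x‖ ^ (δ * m) := by
    rw [← Real.rpow_add hx0]
    congr 1
    field_simp
    ring
  rw [e]
  ring

theorem le_eLpNorm_fracMaximal_powerFun (hn : 0 < n) (hm : 0 < m) (hP : ∀ i, 1 < P i)
    {p q α : ℝ} (hp : 1 / p = ∑ i, 1 / P i) (hp0 : 0 < p) (hq0 : 0 < q)
    (hq : 1 / q = 1 / p - α / n) {δ : ℝ} (hδ0 : 0 < δ) (hδ : δ ≤ n) :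
    ENNReal.ofReal ((2 ^ n) ^ (-(m - α / n)) * (n * 2 ^ n / δ) ^ m *
        (n * 2 ^ n * p / q / δ) ^ (1 / q)) ≤
      eLpNorm (fracMaximal α fun _ : Fin m => powerFun n δ) (ENNReal.ofReal q)
        (volume.withDensity fun x => prodWeight (powerWeight n P δ) x ^ q) := by
  have hn' : (0 : ℝ) < n := by exact_mod_cast hn
  set A := (2 ^ n : ℝ) ^ (-(m - α / n)) * (n * 2 ^ n / δ) ^ m with hA
  set β := m * δ - (n * m - α) with hβ
  -- The weight and the maximal function combine to `‖x‖ ^ (δ * q / p - n)`, whose integral over the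
  -- unit ball yields one more `1 / δ`, hence the factor of order `δ ^ (-1 / q)` in the norm.
  have hexp : (n - δ) * (q * ∑ i, (1 - 1 / P i)) + β * q = δ * q / p - n := by
    rw [Finset.sum_sub_distrib, ← hp]
    simp only [Finset.sum_const, Finset.card_univ, Fintype.card_fin, nsmul_eq_mul, mul_one]
    have h1 : q * (1 / p - α / n) = 1 := by
      rw [← hq, mul_one_div_cancel hq0.ne']
    have h2 : q * n / p = n + q * α := by
      field_simp at h1 ⊢
      linarith
    have h3 : (n - δ) * (q * (m - 1 / p)) + β * q = δ * q / p - q * n / p + q * α := by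
      rw [hβ]
      field_simp
      ring
    rw [h3, h2]
    ring
  rw [eLpNorm_ofReal_eq_lintegral _ _ hq0]
  have hvm : Measurable fun x => prodWeight (powerWeight n P δ) x ^ q :=
    (measurable_prodWeight (measurable_powerWeight P δ)).pow_const q
  have key : ENNReal.ofReal (A ^ q * (n * 2 ^ n * p / q / δ)) ≤
      ∫⁻ x, ‖fracMaximal α (fun _ : Fin m => powerFun n δ) x‖ₑ ^ q
        ∂(volume.withDensity fun x => prodWeight (powerWeight n P δ) x ^ q) := by
    set S : Set (Fin n → ℝ) := Metric.closedBall 0 1 \ {0} with hS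
    have hSm : MeasurableSet S :=
      Metric.isClosed_closedBall.measurableSet.diff (measurableSet_singleton 0)
    have hint := setLIntegral_enorm_rpow_closedBall hn (ε := δ * q / p) (by positivity) one_pos
    calc ENNReal.ofReal (A ^ q * (n * 2 ^ n * p / q / δ))
        = ENNReal.ofReal (A ^ q) *
            ∫⁻ x in Metric.closedBall (0 : Fin n → ℝ) 1, ‖x‖ₑ ^ (δ * q / p - n) := by
          rw [hint, ENNReal.ofReal_mul (by positivity), Real.one_rpow]
          congr 2
          field_simp
      _ = ∫⁻ x in Metric.closedBall (0 : Fin n → ℝ) 1,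
            ENNReal.ofReal (A ^ q) * ‖x‖ₑ ^ (δ * q / p - n) := by
          rw [lintegral_const_mul' _ _ ENNReal.ofReal_ne_top]
      _ = ∫⁻ x in Metric.closedBall (0 : Fin n → ℝ) 1, prodWeight (powerWeight n P δ) x ^ q *
            (ENNReal.ofReal A * ‖x‖ₑ ^ β) ^ q := by
          refine lintegral_congr_ae (ae_restrict_of_ae ?_)
          filter_upwards [ae_ne_zero_of_pos hn] with x hx
          rw [prodWeight_powerWeight_rpow hP hδ, ENNReal.mul_rpow_of_nonneg _ _ hq0.le,
            ← ENNReal.rpow_mul, mul_left_comm,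
            ← ENNReal.rpow_add _ _ (by simpa using hx) enorm_ne_top, hexp,
            ENNReal.ofReal_rpow_of_nonneg (by positivity) hq0.le]
      _ = ∫⁻ x in Metric.closedBall (0 : Fin n → ℝ) 1, (ENNReal.ofReal A * ‖x‖ₑ ^ β) ^ q
            ∂(volume.withDensity fun x => prodWeight (powerWeight n P δ) x ^ q) := by
          rw [setLIntegral_withDensity_eq_setLIntegral_mul _ hvm
            (((measurable_enorm.pow_const β).const_mul _).pow_const q)
            Metric.isClosed_closedBall.measurableSet]
          rfl
      _ ≤ ∫⁻ x in Metric.closedBall (0 : Fin n → ℝ) 1,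
            ‖fracMaximal α (fun _ : Fin m => powerFun n δ) x‖ₑ ^ q
            ∂(volume.withDensity fun x => prodWeight (powerWeight n P δ) x ^ q) := by
          refine lintegral_mono_ae ?_
          filter_upwards [ae_restrict_mem Metric.isClosed_closedBall.measurableSet,
            ae_restrict_of_ae ((withDensity_absolutelyContinuous volume fun x =>
              prodWeight (powerWeight n P δ) x ^ q).ae_le (ae_ne_zero_of_pos hn))] with x hx hx0
          refine ENNReal.rpow_le_rpow ?_ hq0.le
          exact le_fracMaximal_powerFun hn hm α hδ0 hx0 (mem_closedBall_zero_iff.1 hx)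
      _ ≤ _ := setLIntegral_le_lintegral _ _
  refine le_trans (le_of_eq ?_) (ENNReal.rpow_le_rpow key (by positivity))
  rw [ENNReal.ofReal_rpow_of_nonneg (by positivity) (by positivity),
    Real.mul_rpow (by positivity) (by positivity), ← Real.rpow_mul (by positivity),
    mul_one_div_cancel hq0.ne', Real.rpow_one]

theorem le_of_rpow_le_mul_rpow {a b c : ℝ} (h : ∀ t : ℝ, 1 ≤ t → t ^ a ≤ c * t ^ b) : a ≤ b := by
  by_contra! hab
  obtain ⟨t, ht1, ht2⟩ := ((tendsto_rpow_atTop (sub_pos.2 hab)).eventually_gt_atTop c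
    |>.and (Filter.eventually_ge_atTop 1)).exists
  have ht : 0 < t := by linarith
  have h1 := h t ht2
  rw [Real.rpow_sub ht, lt_div_iff₀ (by positivity)] at ht1
  linarith

/-- With `t = 1 / δ → ∞`, the tested inequality forces `m + 1 / q ≤ T * max γ 0 + 1 / p`, and `1 / p
- 1 / q = α / n`. -/
theorem le_of_mem_admissiblePowers (hn : 0 < n) (hm : 0 < m) (hP : ∀ i, 1 < P i)
    {p q α γ : ℝ} (hp : 1 / p = ∑ i, 1 / P i) (hp0 : 0 < p) (hq0 : 0 < q)
    (hq : 1 / q = 1 / p - α / n) (hγ : γ ∈ admissiblePowers n α P q) :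
    m - α / n ≤ q * (m - 1 / p) * max γ 0 := by
  have hn' : (1 : ℝ) ≤ n := by exact_mod_cast hn
  have hsum : ∑ i, (1 - 1 / P i) = m - 1 / p := by
    rw [Finset.sum_sub_distrib, ← hp]
    simp
  obtain ⟨C, hC⟩ := hγ
  obtain ⟨c, hc0, hc⟩ := exists_weightConst_powerWeight_rpow_le hn hP hq0 γ
  rw [hsum] at hc
  set T := q * (m - 1 / p) with hT
  set k : ℝ := (2 ^ n) ^ (-(m - α / n)) * (n * 2 ^ n) ^ m * (n * 2 ^ n * p / q) ^ (1 / q) with hk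
  have hk0 : 0 < k := by positivity
  have main : ∀ t : ℝ, 1 ≤ t → k * t ^ (m + 1 / q) ≤
      C * c * (n * 2 ^ n) ^ (1 / p) * t ^ (T * max γ 0 + 1 / p) := by
    intro t ht
    have ht0 : 0 < t := by linarith
    have hδ0 : 0 < 1 / t := by positivity
    have hδ1 : 1 / t ≤ 1 := (div_le_one ht0).2 ht
    have hw : IsWeight P q (powerWeight n P (1 / t)) :=
      ⟨fun i => (measurable_powerWeight P _ i).aemeasurable,
        (weightConst_powerWeight_le hn hP hq0 hδ0 hδ1).trans_lt
          (ENNReal.rpow_lt_top_of_nonneg (mul_nonneg hq0.le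
            (Finset.sum_nonneg fun i _ => (one_sub_inv_pos (hP i)).le)) ENNReal.ofReal_ne_top)⟩
    have h1 := (le_eLpNorm_fracMaximal_powerFun hn hm hP hp hp0 hq0 hq hδ0
      (hδ1.trans hn')).trans (hC _ hw (fun _ => powerFun n (1 / t))
        fun _ => (measurable_powerFun _).aemeasurable)
    have h2 : ∏ i, eLpNorm (powerFun n (1 / t)) (ENNReal.ofReal (P i))
        (volume.withDensity fun x => (powerWeight n P (1 / t) i x : ℝ≥0∞) ^ P i) =
        ENNReal.ofReal ((n * 2 ^ n) ^ (1 / p) * t ^ (1 / p)) := by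
      rw [Finset.prod_congr rfl fun i _ => eLpNorm_powerFun hn hP hδ0 (hδ1.trans hn') i,
        ENNReal.prod_rpow_eq_rpow_sum_of_nonneg _ _
          fun i _ => one_div_nonneg.2 (by linarith [hP i]), ← hp,
        ENNReal.ofReal_rpow_of_pos (by positivity), ← Real.mul_rpow (by positivity) ht0.le]
      simp
    have h3 : (C : ℝ≥0∞) * weightConst P q (powerWeight n P (1 / t)) ^ γ *
        ENNReal.ofReal ((n * 2 ^ n) ^ (1 / p) * t ^ (1 / p)) ≤
        ENNReal.ofReal (C * (c * t ^ (T * max γ 0)) * ((n * 2 ^ n) ^ (1 / p) * t ^ (1 / p))) := by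
      rw [ENNReal.ofReal_mul (p := C * (c * t ^ (T * max γ 0))) (by positivity),
        ENNReal.ofReal_mul (p := C) (by positivity), ENNReal.ofReal_coe_nnreal]
      gcongr
      simpa using hc (1 / t) hδ0 hδ1
    rw [h2] at h1
    have h4 := (ENNReal.ofReal_le_ofReal_iff (by positivity)).1 (h1.trans h3)
    rw [Real.rpow_add ht0, Real.rpow_add ht0, Real.rpow_natCast]
    simp only [div_div_eq_mul_div, div_one, mul_pow _ t] at h4
    rw [Real.mul_rpow (by positivity) ht0.le] at h4
    rw [hk]
    linarith
  have h := le_of_rpow_le_mul_rpow (a := m + 1 / q) (b := T * max γ 0 + 1 / p)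
    (c := C * c * (n * 2 ^ n) ^ (1 / p) / k) fun t ht => by
      rw [div_mul_eq_mul_div, le_div_iff₀ hk0, mul_comm]
      exact main t ht
  linarith

end MultilinearFractional

/-! ### The two bounds together, and equality for equal exponents -/

theorem corollary1p4 {n m : ℕ} (hn : 0 < n) (hm : 0 < m) (P : Fin m → ℝ) (p q α : ℝ)
    (hP : ∀ i, 1 < P i) (hp : 1 / p = ∑ i, 1 / P i)
    (hα : 0 < α) (hαmn : α < (m : ℝ) * n)
    (hpm : 1 / (m : ℝ) < p) (hpα : p < n / α) (hq : 1 / q = 1 / p - α / n) :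
    -- the upper bound for the best power is itself an admissible power
    1 / q * (1 - α / ((m : ℝ) * n)) * (⨆ i, (P i).conjExponent) ∈
        MultilinearFractional.admissiblePowers n α P q ∧
    -- no power below the lower bound is admissible
    m * p / (q * (m * p - 1)) * (1 - α / ((m : ℝ) * n)) ∈
        lowerBounds (MultilinearFractional.admissiblePowers n α P q) ∧
    -- the resulting two-sided bound for the best power
    m * p / (q * (m * p - 1)) * (1 - α / ((m : ℝ) * n)) ≤
        MultilinearFractional.bestPower n α P q ∧
    MultilinearFractional.bestPower n α P q ≤
        1 / q * (1 - α / ((m : ℝ) * n)) * (⨆ i, (P i).conjExponent) ∧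
    -- equal exponents: the exact value, which is attained and cannot be improved
    ∀ r : ℝ, (∀ i, P i = r) →
      MultilinearFractional.bestPower n α P q =
          r.conjExponent / q * (1 - α / ((m : ℝ) * n)) ∧
      IsLeast (MultilinearFractional.admissiblePowers n α P q)
        (r.conjExponent / q * (1 - α / ((m : ℝ) * n))) := by
  have hn' : (0 : ℝ) < n := by exact_mod_cast hn
  have hm' : (0 : ℝ) < m := by exact_mod_cast hm
  have hp0 : 0 < p := (one_div_pos.2 hm').trans hpm
  obtain ⟨ρ, D⟩ := MultilinearFractional.exists_exponentData hn hm hP hp hα hαmn hp0 hpα hq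
  have hq0 := D.q_pos
  have hmp : 0 < m * p - 1 := by
    rw [div_lt_iff₀ hm'] at hpm
    linarith
  have hupper : 1 / q * (1 - α / ((m : ℝ) * n)) * (⨆ i, (P i).conjExponent) ∈
      MultilinearFractional.admissiblePowers n α P q := by
    have h := MultilinearFractional.div_mem_admissiblePowers hm hn D
    convert h using 1
    ring
  have hlower : m * p / (q * (m * p - 1)) * (1 - α / ((m : ℝ) * n)) ∈
      lowerBounds (MultilinearFractional.admissiblePowers n α P q) := by
    intro γ hγ
    have h := MultilinearFractional.le_of_mem_admissiblePowers hn hm hP hp hp0 hq0 hq hγ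
    have hs := D.s_pos
    -- A nonpositive `γ` would give `m - α / n ≤ 0`, against `α < m * n`.
    have hγ0 : 0 < γ := by
      by_contra! hcon
      rw [max_eq_right hcon, mul_zero] at h
      linarith
    rw [max_eq_left hγ0.le] at h
    have e1 : m * p / (q * (m * p - 1)) * (1 - α / ((m : ℝ) * n)) =
        (m - α / n) / (q * (m - 1 / p)) := by
      field_simp
    have hT : 0 < q * (m - 1 / p) := by
      have : (m : ℝ) - 1 / p = (m * p - 1) / p := by field_simp
      rw [this]
      positivity
    rw [e1, div_le_iff₀ hT]
    linarith
  refine ⟨hupper, hlower, le_csInf ⟨_, hupper⟩ hlower, csInf_le ⟨_, hlower⟩ hupper,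
    fun r hr => ?_⟩
  have : Nonempty (Fin m) := ⟨⟨0, hm⟩⟩
  have hr1 : 1 < r := hr (Classical.arbitrary _) ▸ hP _
  have hpr : m * p = r := by
    simp only [hr, Finset.sum_const, Finset.card_univ, Fintype.card_fin, nsmul_eq_mul] at hp
    have : 0 < r := by linarith
    field_simp at hp
    linarith
  have hleast : IsLeast (MultilinearFractional.admissiblePowers n α P q)
      (r.conjExponent / q * (1 - α / ((m : ℝ) * n))) := by
    constructor
    · convert hupper using 1
      simp only [hr, ciSup_const]
      ring
    · convert hlower using 1
      rw [hpr, Real.conjExponent, div_div, mul_comm q]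
  exact ⟨hleast.csInf_eq, hleast⟩
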